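/- **Definitions.** For $u\in\mathbb R$ put $u_+:=\max(0,u)$, and for $\alpha\in[0,\infty]$ let $h_0(u):=\mathbf 1\{u\ge0\}$, $h_\alpha(u):=(1+u/\alpha)_+^\alpha$ for $0<\alpha<\infty$, and $h_\infty(u):=e^u$. For a real-valued random variable (r.v.) $X$, $x\in\mathbb R$ and $p\in(0,1)$ let $$P_\alpha(X;x):=\inf_{\lambda\in(0,\infty)}\mathsf E\,h_\alpha\big(\lambda(X-x)\big)\in[0,\infty],\qquad Q_\alpha(X;p):=\inf\{x\in\mathbb R\colon P_\alpha(X;x)<p\}\in[-\infty,\infty].$$ Let $\Lambda_X:=\{\lambda\in(0,\infty)\colon\mathsf E e^{\lambda X}<\infty\}$. Let $\mathcal X_0$ be the set of all r.v.'s $X$, $\mathcal X_\alpha:=\{X\colon \mathsf E X_+^\alpha<\infty\}$ for $0<\alpha<\infty$, and $\mathcal X_\infty:=\{X\colon\Lambda_X\ne\emptyset\}$. Let $x_*:=\sup\operatorname{supp}X\in(-\infty,\infty]$ (the supremum of the support of the distribution of $X$) and $p_*:=\mathsf P(X=x_*)$. Let $T_\alpha:=\mathbb R$ and $g_{\alpha;t}(u):=(u-t)_+^\alpha$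 for $0\le\alpha<\infty$ (with $0^0:=0$), and $T_\infty:=(0,\infty)$ and $g_{\infty;t}(u):=e^{u/t}$. Let $\mathcal H_\alpha$ be the set of all functions $g\colon\mathbb R\to\mathbb R$ of the form $g(u)=\int_{T_\alpha}g_{\alpha;t}(u)\,\mu(dt)$ for all real $u$, where $\mu$ is a nonnegative Borel measure on $T_\alpha$. One says that $Y$ dominates $X$ stochastically with order $\alpha+1$, and writes $X\overset{\alpha+1}{\le}Y$, if $\mathsf E g(X)\le\mathsf E g(Y)$ for all $g\in\mathcal H_\alpha$. **Theorem.** Let $\alpha\in[0,\infty]$, $p\in(0,1)$ and $X\in\mathcal X_\alpha$. 1. *Model-independence:* $Q_\alpha(X;p)$ depends on $X$ only through the distribution of $X$. 2. *Monotonicity in $X$:* if $X\overset{\alpha+1}{\le}Y$ for a r.v. $Y$, then $Q_\alpha(X;p)\le Q_\alpha(Y;p)$. The same conclusion holds if $X\overset{\gamma}{\le}Y$ for some $\gamma\in[1,\alpha+1]$; in particular, it holds if $X\le Y$. 3. *Monotonicity in $\alpha$:* $Q_\alpha(X;p)\le Q_\beta(X;p)$ whenever $\alpha\le\beta\le\infty$.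 4. *Monotonicity in $p$:* $Q_\alpha(X;p)$ is nonincreasing in $p\in(0,1)$ and, if $\alpha\in(0,\infty]$, strictly decreasing in $p\in[p_*,1)\cap(0,1)$. 5. *Finiteness:* $Q_\alpha(X;p)\in\mathbb R$. 6. *Concavity in $p^{-1/\alpha}$ or in $\ln\frac1p$:* $Q_\alpha(X;p)$ is a concave function of $p^{-1/\alpha}\in(1,\infty)$ if $\alpha\in(0,\infty)$, and $Q_\infty(X;p)$ is a concave function of $\ln\frac1p\in(0,\infty)$. 7. *Stability in $p$:* $Q_\alpha(X;p)$ is continuous in $p\in(0,1)$ if $\alpha\in(0,\infty]$. 8. *Stability in $X$:* let $\alpha\in(0,\infty]$ and let $(X_n)$ be a sequence of real-valued r.v.'s converging to $X$ in distribution such that, as $N\to\infty$, $\sup_n\mathsf E(X_n)_+^\alpha\mathbf 1\{X_n>N\}\to0$ if $\alpha<\infty$, and $\sup_n\mathsf E e^{\lambda X_n}\mathbf 1\{X_n>N\}\to0$ for each $\lambda\in\Lambda_X$ if $\alpha=\infty$. Then $Q_\alpha(X_n;p)\to Q_\alpha(X;p)$. 9. *Stability in $\alpha$:* let $\alpha\in(0,\infty]$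 and let $(\alpha_n)$ be a sequence in $[0,\infty)$ converging to $\alpha$, with $X\in\mathcal X_\beta$ for $\beta:=\sup_n\alpha_n$. Then $Q_{\alpha_n}(X;p)\to Q_\alpha(X;p)$. 10. *Translation invariance:* $Q_\alpha(X+c;p)=Q_\alpha(X;p)+c$ for all real $c$. 11. *Consistency:* $Q_\alpha(c;p)=c$ for all real constants $c$. 12. *Sensitivity:* suppose that $X\ge0$. If $\mathsf P(X>0)>0$ and $\alpha\in(0,\infty]$, then $Q_\alpha(X;p)>0$; if $\mathsf P(X>0)>p$, then $Q_0(X;p)>0$. 13. *Positive homogeneity:* $Q_\alpha(\kappa X;p)=\kappa\,Q_\alpha(X;p)$ for all real $\kappa\ge0$. 14. *Subadditivity:* if $\alpha\in[1,\infty]$ and $Y\in\mathcal X_\alpha$ is defined on the same probability space as $X$, then $Q_\alpha(X+Y;p)\le Q_\alpha(X;p)+Q_\alpha(Y;p)$. 15. *Convexity:* if $\alpha\in[1,\infty]$ and $Y\in\mathcal X_\alpha$ is defined on the same probability space as $X$, then $Q_\alpha\big((1-t)X+tY;p\big)\le(1-t)Q_\alpha(X;p)+t\,Q_\alpha(Y;p)$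 for all $t\in(0,1)$. -/

import Mathlib

open MeasureTheory ProbabilityTheory Set Filter Topology
open scoped ENNReal NNReal

namespace QuantileBounds

noncomputable section

/-- The function `h_α`: `h_0(u) = 1{u ≥ 0}`, `h_α(u) = (1 + u/α)_+^α` for `0 < α < ∞`,
and `h_∞(u) = e^u`. -/
def h (α : ℝ≥0∞) (u : ℝ) : ℝ :=
  if α = 0 then (if 0 ≤ u then 1 else 0)
  else if α = ∞ then Real.exp u
  else (max 0 (1 + u / α.toReal)) ^ α.toReal

/-- The generalized moment `A_α(X; x)(l) = E h_α(l (X - x))`, with values in `[0, ∞]`. -/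
def A {Ω : Type*} [MeasurableSpace Ω] (α : ℝ≥0∞) (μ : Measure Ω) (X : Ω → ℝ) (x l : ℝ) : ℝ≥0∞ :=
  ∫⁻ ω, ENNReal.ofReal (h α (l * (X ω - x))) ∂μ

/-- The tail probability bound `P_α(X; x) = inf_{l > 0} A_α(X; x)(l)`. -/
def P {Ω : Type*} [MeasurableSpace Ω] (α : ℝ≥0∞) (μ : Measure Ω) (X : Ω → ℝ) (x : ℝ) : ℝ≥0∞ :=
  ⨅ l ∈ Ioi (0 : ℝ), A α μ X x l

/-- The set `E_{α,X}(p)` of all real `x` with `P_α(X; x) < p`. -/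
def E {Ω : Type*} [MeasurableSpace Ω] (α : ℝ≥0∞) (μ : Measure Ω) (X : Ω → ℝ) (p : ℝ) : Set ℝ :=
  {x : ℝ | P α μ X x < ENNReal.ofReal p}

/-- The quantile bound `Q_α(X; p) = inf {x ∈ ℝ : P_α(X; x) < p}`, an extended real number
(so that the infimum of the empty set is `∞`, and that of a set unbounded below is `-∞`). -/
def Q {Ω : Type*} [MeasurableSpace Ω] (α : ℝ≥0∞) (μ : Measure Ω) (X : Ω → ℝ) (p : ℝ) : EReal :=
  sInf ((fun x : ℝ => (x : EReal)) '' E α μ X p)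

/-- The set `Λ_X` of all real `l > 0` with `E e^{l X} < ∞`. -/
def Lam {Ω : Type*} [MeasurableSpace Ω] (μ : Measure Ω) (X : Ω → ℝ) : Set ℝ :=
  {l : ℝ | 0 < l ∧ ∫⁻ ω, ENNReal.ofReal (Real.exp (l * X ω)) ∂μ < ∞}

/-- Membership of `X` in the class of those real-valued random variables for which the bounds of
index `α` are considered: no moment condition if `α = 0`, `E X_+^α < ∞` if `0 < α < ∞`, and
`E e^{l X} < ∞` for some `l > 0` if `α = ∞`. -/
def MemX {Ω : Type*} [MeasurableSpace Ω] (α : ℝ≥0∞) (μ : Measure Ω) (X : Ω → ℝ) : Prop :=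
  Measurable X ∧
    (α ≠ 0 → α ≠ ∞ → ∫⁻ ω, ENNReal.ofReal ((max 0 (X ω)) ^ α.toReal) ∂μ < ∞) ∧
    (α = ∞ → (Lam μ X).Nonempty)

/-- The parameter set `T_α`: the real line if `α < ∞`, and `(0, ∞)` if `α = ∞`. -/
def T (α : ℝ≥0∞) : Set ℝ := if α = ∞ then Ioi 0 else univ

/-- The function `g_{α;t}(u)`: `(u - t)_+^α` if `α < ∞` (with `0^0 = 0`, so that it is `1{u > t}`
if `α = 0`), and `e^{u/t}` if `α = ∞`. -/
def g (α : ℝ≥0∞) (t u : ℝ) : ℝ :=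
  if α = 0 then (if t < u then 1 else 0)
  else if α = ∞ then Real.exp (u / t)
  else (max 0 (u - t)) ^ α.toReal

/-- The class of all (finite, nonnegative) functions `f : ℝ → ℝ` of the form
`f(u) = ∫_{T_α} g_{α;t}(u) ν(dt)` for all real `u`, for some nonnegative Borel measure `ν`
on `T_α`. -/
def H (α : ℝ≥0∞) : Set (ℝ → ℝ) :=
  {f | (∀ u, 0 ≤ f u) ∧
    ∃ ν : Measure ℝ, ∀ u, ENNReal.ofReal (f u) = ∫⁻ t in T α, ENNReal.ofReal (g α t u) ∂ν}

/-- Stochastic dominance of order `α + 1`: `E f(X) ≤ E f(Y)` for all `f` in the class `H α`.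
The two random variables may be defined on different probability spaces. -/
def StochDom {Ω Ω' : Type*} [MeasurableSpace Ω] [MeasurableSpace Ω'] (α : ℝ≥0∞)
    (μ : Measure Ω) (X : Ω → ℝ) (ν : Measure Ω') (Y : Ω' → ℝ) : Prop :=
  ∀ f ∈ H α, ∫⁻ ω, ENNReal.ofReal (f (X ω)) ∂μ ≤ ∫⁻ ω, ENNReal.ofReal (f (Y ω)) ∂ν

/-- `x_* = sup supp X`, an extended real number. -/
def xStar {Ω : Type*} [MeasurableSpace Ω] (μ : Measure Ω) (X : Ω → ℝ) : EReal :=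
  sSup ((fun x : ℝ => (x : EReal)) '' (μ.map X).support)

/-- `p_* = P(X = x_*)` (which is `0` if `x_* = ∞`). -/
def pStar {Ω : Type*} [MeasurableSpace Ω] (μ : Measure Ω) (X : Ω → ℝ) : ℝ≥0∞ :=
  μ {ω | (X ω : EReal) = xStar μ X}

/-- The uniform integrability condition for a sequence `(X_n)` relative to `X`, where `X_n` is
defined on its own probability space `(S n, ν n)`:
`sup_n E (X_n)_+^α 1{X_n > N} → 0` as `N → ∞` if `0 < α < ∞`, and
`sup_n E e^{l X_n} 1{X_n > N} → 0` as `N → ∞` for each `l ∈ Λ_X` if `α = ∞`. -/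
def UnifIntCond {Ω : Type*} [MeasurableSpace Ω] (α : ℝ≥0∞) (μ : Measure Ω) (X : Ω → ℝ)
    {S : ℕ → Type*} [∀ n, MeasurableSpace (S n)] (ν : ∀ n, Measure (S n))
    (Xs : ∀ n, S n → ℝ) : Prop :=
  (α ≠ 0 → α ≠ ∞ →
    Tendsto (fun N : ℝ => ⨆ n, ∫⁻ ω, {ω | N < Xs n ω}.indicator
        (fun ω => ENNReal.ofReal ((max 0 (Xs n ω)) ^ α.toReal)) ω ∂(ν n)) atTop (𝓝 0)) ∧
  (α = ∞ → ∀ l ∈ Lam μ X,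
    Tendsto (fun N : ℝ => ⨆ n, ∫⁻ ω, {ω | N < Xs n ω}.indicator
        (fun ω => ENNReal.ofReal (Real.exp (l * Xs n ω))) ω ∂(ν n)) atTop (𝓝 0))

end

end QuantileBounds

open QuantileBounds

universe u v w

namespace QuantileBounds

/-! For each fixed `l > 0` the moment `A` is monotone in `X`, `x` and `α`, so comparing moments, or
membership in the upward closed sets `E`, compares the values of `Q`. At `α = 0` the bound is the
ordinary quantile, which therefore bounds every `Q α` from below (`le_Q_of_le_measure`).

The behaviour in `p` rests on `exists_affine`: for `α ≠ 0`, solving `A < q` for `x` exhibits `E` as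
a union of open rays with end points affine in `levelParam α q`. Thus `Q` is an infimum of affine
functions of that parameter, hence concave and continuous. Being also monotone, it stays constant
beyond any two parameters where it agrees; as quantiles at small levels approach the top of the
support, that constant bounds `X` (`le_of_Q_eq`). Strict decrease and sensitivity follow.

For dominance, each kernel `g α t` is, up to a constant, a Beta or Gamma mixture of kernels `g β s`
with `β < α`, and for `α ≠ 0` the moment `A` is a multiple of the mean of such a kernel.
Subadditivity is convexity of `h α` for `α ≥ 1`, with the two multipliers combined harmonically.

For stability, one half is lower semicontinuity: compactness of `[0, ∞]` gives a limiting
multiplier, and a Fatou lemma for weak convergence treats it. The other half keeps one multiplier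
fixed and controls its moment by uniform integrability or dominated convergence. -/

/-! ### The functions `h α`: monotonicity, joint continuity, convexity. -/

lemma h_zero_left (u : ℝ) : h 0 u = if 0 ≤ u then 1 else 0 := by simp [h]

lemma h_top (u : ℝ) : h ∞ u = Real.exp u := by simp [h]

lemma h_of_ne {α : ℝ≥0∞} (h0 : α ≠ 0) (h1 : α ≠ ∞) (u : ℝ) :
    h α u = (max 0 (1 + u / α.toReal)) ^ α.toReal := by simp [h, h0, h1]

lemma h_nonneg (α : ℝ≥0∞) (u : ℝ) : 0 ≤ h α u := by
  unfold h
  split_ifs <;> positivity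

lemma h_mono (α : ℝ≥0∞) : Monotone (h α) := by
  intro u v huv
  unfold h
  split_ifs
  · rfl
  · linarith
  · norm_num
  · rfl
  · exact Real.exp_le_exp.2 huv
  · gcongr

lemma h_zero (α : ℝ≥0∞) : h α 0 = 1 := by simp [h]

lemma one_le_h (α : ℝ≥0∞) {u : ℝ} (hu : 0 ≤ u) : 1 ≤ h α u := by
  simpa [h_zero] using h_mono α hu

lemma h_le_one (α : ℝ≥0∞) {u : ℝ} (hu : u ≤ 0) : h α u ≤ 1 := by
  simpa [h_zero] using h_mono α hu

/-- The functions `h α` increase with `α`. -/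
lemma h_mono_left {α β : ℝ≥0∞} (hαβ : α ≤ β) (u : ℝ) : h α u ≤ h β u := by
  rcases eq_or_ne α 0 with rfl | hα0
  · rw [h_zero_left]
    split_ifs with hu
    · exact one_le_h β hu
    · exact h_nonneg β u
  have hβ0 : β ≠ 0 := fun hb => hα0 (le_antisymm (hb ▸ hαβ) bot_le)
  rcases eq_or_ne α ∞ with rfl | hα1
  · rw [top_le_iff.1 hαβ]
  have ha : 0 < α.toReal := ENNReal.toReal_pos hα0 hα1
  rw [h_of_ne hα0 hα1]
  rcases le_or_gt (1 + u / α.toReal) 0 with hu | hu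
  · rw [max_eq_left hu, Real.zero_rpow ha.ne']
    exact h_nonneg β u
  rw [max_eq_right hu.le]
  rcases eq_or_ne β ∞ with rfl | hβ1
  · rw [h_top]
    calc (1 + u / α.toReal) ^ α.toReal ≤ (Real.exp (u / α.toReal)) ^ α.toReal := by
          gcongr
          linarith [Real.add_one_le_exp (u / α.toReal)]
      _ = Real.exp u := by rw [← Real.exp_mul]; field_simp
  have hb : 0 < β.toReal := ENNReal.toReal_pos hβ0 hβ1
  have hab : α.toReal ≤ β.toReal := ENNReal.toReal_mono hβ1 hαβ
  rw [h_of_ne hβ0 hβ1]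
  have hv : -1 ≤ u / β.toReal := by
    rw [le_div_iff₀ hb]
    have : 0 < α.toReal + u := by
      have := mul_pos ha hu
      rwa [mul_add, mul_one, mul_div_cancel₀ _ ha.ne'] at this
    linarith
  -- Bernoulli with exponent `β / α ≥ 1` gives `1 + u/α ≤ (1 + u/β) ^ (β/α)`; raising to the power
  -- `α` finishes.
  have hBern := one_add_mul_self_le_rpow_one_add hv ((one_le_div ha).2 hab)
  have he : β.toReal / α.toReal * (u / β.toReal) = u / α.toReal := by field_simp
  rw [he] at hBern
  rw [max_eq_right (by linarith : 0 ≤ 1 + u / β.toReal)]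
  calc (1 + u / α.toReal) ^ α.toReal
      ≤ ((1 + u / β.toReal) ^ (β.toReal / α.toReal)) ^ α.toReal := by gcongr
    _ = (1 + u / β.toReal) ^ β.toReal := by
        rw [← Real.rpow_mul (by linarith)]; field_simp

lemma h_le_exp (α : ℝ≥0∞) (u : ℝ) : h α u ≤ Real.exp u := by
  simpa [h_top] using h_mono_left (le_top : α ≤ ∞) u

@[fun_prop]
lemma measurable_h (α : ℝ≥0∞) : Measurable (h α) := (h_mono α).measurable

/-- The function `h` is jointly continuous at every `(α, u)` with `α ≠ 0`. -/
lemma tendsto_h {ι : Type*} {F : Filter ι} {a : ι → ℝ≥0∞} {α : ℝ≥0∞} (hα : α ≠ 0)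
    (ha : Tendsto a F (𝓝 α)) {v : ι → ℝ} {w : ℝ} (hv : Tendsto v F (𝓝 w)) :
    Tendsto (fun i => h (a i) (v i)) F (𝓝 (h α w)) := by
  have key : ∀ {b : ι → ℝ≥0∞} {γ : ℝ≥0∞}, γ ≠ 0 → γ ≠ ∞ → Tendsto b F (𝓝 γ) →
      Tendsto (fun i => h (b i) (v i)) F (𝓝 (h γ w)) := by
    intro b γ h0 h1 hb
    have hpos : 0 < γ.toReal := ENNReal.toReal_pos h0 h1
    have hbr : Tendsto (fun i => (b i).toReal) F (𝓝 γ.toReal) :=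
      (ENNReal.tendsto_toReal h1).comp hb
    have hlim : Tendsto (fun i => (max 0 (1 + v i / (b i).toReal)) ^ (b i).toReal) F
        (𝓝 (h γ w)) := by
      rw [h_of_ne h0 h1]
      exact (tendsto_const_nhds.max (tendsto_const_nhds.add (hv.div hbr hpos.ne'))).rpow hbr
        (Or.inr hpos)
    refine hlim.congr' ?_
    filter_upwards [hb.eventually_ne h0, hb.eventually_ne h1] with i hi0 hi1
    rw [h_of_ne hi0 hi1]
  rcases eq_or_ne α ∞ with rfl | hα1
  swap
  · exact key hα hα1 ha
  rw [tendsto_order]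
  refine ⟨fun c hc => ?_, fun c hc => ?_⟩
  -- Lower bound at `α = ∞`: fix a finite index `s` with `c < h s w`. Eventually `a i > s`, so `h (a
  -- i) ≥ h s`, and continuity of `h s` suffices. The upper bound is `h ≤ exp`.
  · have hexp : Tendsto (fun s : ℝ => (1 + w / s) ^ s) atTop (𝓝 (Real.exp w)) :=
      Real.tendsto_one_add_div_rpow_exp w
    rw [h_top] at hc
    have hw : Tendsto (fun s : ℝ => 1 + w / s) atTop (𝓝 1) := by
      simpa using (tendsto_const_nhds (x := (1 : ℝ))).add ((tendsto_const_nhds (x := w)).div_atTop tendsto_id)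
    obtain ⟨s, hs, hs0, hs1⟩ := ((hexp.eventually_const_lt hc).and
      ((eventually_gt_atTop (0 : ℝ)).and (hw.eventually_const_lt one_pos))).exists
    have e0 : ENNReal.ofReal s ≠ 0 := by simpa using hs0
    have e1 : ENNReal.ofReal s ≠ ∞ := ENNReal.ofReal_ne_top
    have hcs : c < h (ENNReal.ofReal s) w := by
      rwa [h_of_ne e0 e1, ENNReal.toReal_ofReal hs0.le, max_eq_right hs1.le]
    filter_upwards [(key e0 e1 tendsto_const_nhds).eventually_const_lt hcs,
      ha.eventually_const_lt e1.lt_top] with i hi hi'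
    exact hi.trans_le (h_mono_left hi'.le _)
  · rw [h_top] at hc
    filter_upwards [((Real.continuous_exp.tendsto w).comp hv).eventually_lt_const hc] with i hi
    exact (h_le_exp _ _).trans_lt hi

lemma continuous_h {α : ℝ≥0∞} (hα : α ≠ 0) : Continuous (h α) :=
  continuous_iff_continuousAt.2 fun _ => tendsto_h hα tendsto_const_nhds tendsto_id

lemma tendsto_h_atTop {α : ℝ≥0∞} (hα : α ≠ 0) : Tendsto (h α) atTop atTop := by
  rcases eq_or_ne α ∞ with rfl | hα1
  · exact Real.tendsto_exp_atTop.congr fun u => (h_top u).symm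
  have hpos : 0 < α.toReal := ENNReal.toReal_pos hα hα1
  refine Tendsto.congr (fun u => (h_of_ne hα hα1 u).symm) ?_
  refine (tendsto_rpow_atTop hpos).comp (tendsto_atTop_mono (fun u => le_max_right _ _) ?_)
  exact tendsto_atTop_add_const_left _ _ (tendsto_id.atTop_div_const hpos)

lemma tendsto_h_atBot {α : ℝ≥0∞} : Tendsto (h α) atBot (𝓝 0) :=
  squeeze_zero (h_nonneg α) (h_le_exp α) Real.tendsto_exp_atBot

lemma convexOn_h {α : ℝ≥0∞} (hα : 1 ≤ α) : ConvexOn ℝ univ (h α) := by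
  rcases eq_or_ne α ∞ with rfl | hα1
  · rw [show h ∞ = Real.exp from funext h_top]
    exact convexOn_exp
  have h0 : α ≠ 0 := (one_pos.trans_le hα).ne'
  have hone : 1 ≤ α.toReal := by simpa using ENNReal.toReal_mono hα1 hα
  rw [show h α = fun u => (max 0 (1 + u / α.toReal)) ^ α.toReal from funext (h_of_ne h0 hα1)]
  have haff : ConvexOn ℝ univ (fun u : ℝ => 1 + u / α.toReal) := by
    refine ⟨convex_univ, fun x _ y _ a b _ _ hab => le_of_eq ?_⟩
    simp only [smul_eq_mul]
    field_simp
    linear_combination (α.toReal) * (-hab)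
  have hmax : ConvexOn ℝ univ (fun u : ℝ => max 0 (1 + u / α.toReal)) :=
    (convexOn_const 0 convex_univ).sup haff
  refine ⟨convex_univ, fun x _ y _ a b ha hb hab => ?_⟩
  have hr := (convexOn_rpow hone).2 (x := max 0 (1 + x / α.toReal))
    (y := max 0 (1 + y / α.toReal)) (mem_Ici.2 (le_max_left _ _))
    (mem_Ici.2 (le_max_left _ _)) ha hb hab
  refine le_trans ?_ hr
  exact Real.rpow_le_rpow (le_max_left _ _) (hmax.2 (mem_univ x) (mem_univ y) ha hb hab)
    (by linarith)

/-! ### Elementary comparisons, quantile bounds and subadditivity. -/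

section Basic

variable {Ω Ω' : Type*} [MeasurableSpace Ω] [MeasurableSpace Ω'] {μ : Measure Ω} {ν : Measure Ω'}
  {X : Ω → ℝ} {Y : Ω' → ℝ} {α β : ℝ≥0∞} {p q x y : ℝ}

lemma mem_E_iff : x ∈ E α μ X p ↔ ∃ l, 0 < l ∧ A α μ X x l < ENNReal.ofReal p := by
  simp [E, P, iInf_lt_iff]

lemma A_anti (hxy : x ≤ y) {l : ℝ} (hl : 0 ≤ l) : A α μ X y l ≤ A α μ X x l := by
  refine lintegral_mono fun ω => ENNReal.ofReal_le_ofReal (h_mono α ?_)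
  gcongr

lemma mem_E_of_le (hx : x ∈ E α μ X p) (hxy : x ≤ y) : y ∈ E α μ X p := by
  obtain ⟨l, hl, hA⟩ := mem_E_iff.1 hx
  exact mem_E_iff.2 ⟨l, hl, (A_anti hxy hl.le).trans_lt hA⟩

lemma E_mono (hpq : p ≤ q) : E α μ X p ⊆ E α μ X q :=
  fun _ hx => lt_of_lt_of_le hx (ENNReal.ofReal_le_ofReal hpq)

lemma Q_le (hx : x ∈ E α μ X p) : Q α μ X p ≤ x := sInf_le ⟨x, hx, rfl⟩

lemma le_Q {z : EReal} (hz : ∀ x ∈ E α μ X p, z ≤ (x : EReal)) : z ≤ Q α μ X p :=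
  le_sInf (by rintro _ ⟨x, hx, rfl⟩; exact hz x hx)

lemma mem_E_of_Q_lt (hx : Q α μ X p < x) : x ∈ E α μ X p := by
  obtain ⟨_, ⟨y, hy, rfl⟩, hyx⟩ := sInf_lt_iff.1 hx
  exact mem_E_of_le hy (EReal.coe_lt_coe_iff.1 hyx).le

lemma le_Q_of_notMem (hx : x ∉ E α μ X p) : (x : EReal) ≤ Q α μ X p :=
  not_lt.1 fun hlt => hx (mem_E_of_Q_lt hlt)

/-- To bound `Q` by a real number it suffices to show that all larger reals lie in `E`. -/
lemma Q_le_of_forall_gt (hx : ∀ y, x < y → y ∈ E α μ X p) : Q α μ X p ≤ x := by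
  refine le_of_forall_gt_imp_ge_of_dense fun z hz => ?_
  obtain ⟨y, hy1, hy2⟩ := EReal.lt_iff_exists_real_btwn.1 hz
  exact (Q_le (hx y (EReal.coe_lt_coe_iff.1 hy1))).trans hy2.le

lemma Q_mono_of_E_subset (hE : E β ν Y q ⊆ E α μ X p) : Q α μ X p ≤ Q β ν Y q :=
  le_Q fun _ hx => Q_le (hE hx)

lemma Q_mono_of_A_le
    (hA : ∀ x l, 0 < l → A α μ X x l ≤ A β ν Y x l) : Q α μ X p ≤ Q β ν Y p := by
  refine Q_mono_of_E_subset fun x hx => ?_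
  obtain ⟨l, hl, hA'⟩ := mem_E_iff.1 hx
  exact mem_E_iff.2 ⟨l, hl, (hA x l hl).trans_lt hA'⟩

lemma Q_anti (hpq : p ≤ q) : Q α μ X q ≤ Q α μ X p :=
  Q_mono_of_E_subset (E_mono hpq)

lemma A_mono_left (hαβ : α ≤ β) (x l : ℝ) : A α μ X x l ≤ A β μ X x l :=
  lintegral_mono fun _ => ENNReal.ofReal_le_ofReal (h_mono_left hαβ _)

lemma Q_mono_left (hαβ : α ≤ β) : Q α μ X p ≤ Q β μ X p :=
  Q_mono_of_A_le fun x l _ => A_mono_left hαβ x l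

lemma Q_mono_of_ae_le {Y : Ω → ℝ} (hXY : ∀ᵐ ω ∂μ, X ω ≤ Y ω) : Q α μ X p ≤ Q α μ Y p := by
  refine Q_mono_of_A_le fun x l hl => lintegral_mono_ae ?_
  filter_upwards [hXY] with ω hω
  refine ENNReal.ofReal_le_ofReal (h_mono α ?_)
  gcongr

lemma A_map (hX : AEMeasurable X μ) (x l : ℝ) :
    A α μ X x l = ∫⁻ u, ENNReal.ofReal (h α (l * (u - x))) ∂(μ.map X) := by
  rw [lintegral_map' (by fun_prop) hX]
  rfl

lemma Q_congr_identDistrib (hXY : IdentDistrib X Y μ ν) : Q α μ X p = Q α ν Y p := by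
  have hA : ∀ x l, A α μ X x l = A α ν Y x l := fun x l => by
    rw [A_map hXY.aemeasurable_fst, A_map hXY.aemeasurable_snd, hXY.map_eq]
  exact le_antisymm (Q_mono_of_A_le fun x l _ => (hA x l).le)
    (Q_mono_of_A_le fun x l _ => (hA x l).ge)

/-- The sign of `l * (X - x)` does not depend on `l > 0`, so the infimum over `l` is vacuous and `Q
0` is the usual quantile. -/
lemma A_zero (hX : Measurable X) {l : ℝ} (hl : 0 < l) : A 0 μ X x l = μ {ω | x ≤ X ω} := by
  have hf : ∀ ω, ENNReal.ofReal (h 0 (l * (X ω - x))) =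
      {ω | x ≤ X ω}.indicator (fun _ => (1 : ℝ≥0∞)) ω := by
    intro ω
    by_cases hω : x ≤ X ω
    · have : 0 ≤ l * (X ω - x) := mul_nonneg hl.le (by linarith)
      simp [h_zero_left, this, hω]
    · have : ¬ 0 ≤ l * (X ω - x) := by
        rw [not_le] at hω ⊢
        exact mul_neg_of_pos_of_neg hl (by linarith)
      simp [h_zero_left, this, hω]
  simp_rw [A, hf]
  rw [lintegral_indicator (measurableSet_le measurable_const hX), lintegral_one,
    Measure.restrict_apply_univ]

lemma mem_E_zero_iff (hX : Measurable X) :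
    x ∈ E 0 μ X p ↔ μ {ω | x ≤ X ω} < ENNReal.ofReal p := by
  rw [mem_E_iff]
  constructor
  · rintro ⟨l, hl, hA⟩
    rwa [A_zero hX hl] at hA
  · intro hlt
    exact ⟨1, one_pos, by rwa [A_zero hX one_pos]⟩

/-- A lower bound on `Q` by quantiles. -/
lemma le_Q_of_le_measure (hX : Measurable X) (hx : ENNReal.ofReal p ≤ μ {ω | x ≤ X ω}) :
    (x : EReal) ≤ Q α μ X p :=
  (le_Q_of_notMem (by rw [mem_E_zero_iff hX]; exact hx.not_gt)).trans
    (Q_mono_left (zero_le : (0 : ℝ≥0∞) ≤ α))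

/-- If `X ≤ x` almost surely, then the bounds `A` at `x` decrease to `P(X = x)` or less. -/
lemma tendsto_A_of_ae_le [IsFiniteMeasure μ] (hX : Measurable X)
    (hx : ∀ᵐ ω ∂μ, X ω ≤ x) :
    Tendsto (fun n : ℕ => A α μ X x n) atTop (𝓝 (μ {ω | X ω = x})) := by
  have hm : MeasurableSet {ω | X ω = x} := hX (measurableSet_singleton x)
  rw [← lintegral_indicator_one hm]
  refine tendsto_lintegral_of_dominated_convergence (fun _ => 1) (fun n => by fun_prop) ?_
    (by simp) ?_
  · intro n
    filter_upwards [hx] with ω hω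
    rw [ENNReal.ofReal_le_one]
    exact h_le_one α (mul_nonpos_of_nonneg_of_nonpos (by positivity) (by linarith))
  · filter_upwards [hx] with ω hω
    rcases hω.lt_or_eq with hlt | heq
    · have h0 : {ω | X ω = x}.indicator (1 : Ω → ℝ≥0∞) ω = 0 := by simp [hlt.ne]
      rw [h0, ← ENNReal.ofReal_zero]
      refine (ENNReal.continuous_ofReal.tendsto 0).comp (tendsto_h_atBot.comp ?_)
      exact tendsto_natCast_atTop_atTop.atTop_mul_const_of_neg (by linarith)
    · simp [heq, h_zero]

lemma mem_E_of_ae_le [IsFiniteMeasure μ] (hX : Measurable X)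
    (hx : ∀ᵐ ω ∂μ, X ω ≤ x) (hlt : μ {ω | X ω = x} < ENNReal.ofReal p) : x ∈ E α μ X p := by
  obtain ⟨n, hn, hn0⟩ := (((tendsto_A_of_ae_le hX hx).eventually_lt_const hlt).and
    (eventually_gt_atTop 0)).exists
  exact mem_E_iff.2 ⟨n, by exact_mod_cast hn0, hn⟩

lemma Q_le_of_ae_le [IsFiniteMeasure μ] (hX : Measurable X) (hp : 0 < p)
    (hx : ∀ᵐ ω ∂μ, X ω ≤ x) : Q α μ X p ≤ x := by
  refine (Q_mono_left le_top).trans (Q_le_of_forall_gt (α := ∞) fun y hy => ?_)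
  refine mem_E_of_ae_le hX (hx.mono fun ω hω => hω.trans hy.le) ?_
  have : μ {ω | X ω = y} = 0 := by
    refine measure_mono_null (fun ω hω => ?_) (ae_iff.1 hx)
    simp only [mem_ofPred_eq] at hω ⊢
    linarith
  rw [this]
  exact ENNReal.ofReal_pos.2 hp

lemma Q_const [IsProbabilityMeasure μ] (c : ℝ) (hp : p ∈ Ioo (0 : ℝ) 1) :
    Q α μ (fun _ => c) p = c := by
  refine le_antisymm (Q_le_of_ae_le measurable_const hp.1 (by simp)) ?_
  refine le_Q_of_le_measure measurable_const ?_
  simpa using hp.2.le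

/-- One inequality is enough: the reverse one in `Q_add_const` is this bound applied with `-c`.
`Q_mul_const_le` serves `Q_const_mul` in the same way. -/
lemma Q_add_const_le (c : ℝ) {r : ℝ} (hr : Q α μ X p ≤ r) :
    Q α μ (fun ω => X ω + c) p ≤ (r + c : ℝ) := by
  refine Q_le_of_forall_gt fun y hy => ?_
  have hmem : y - c ∈ E α μ X p := mem_E_of_Q_lt (hr.trans_lt (by
    rw [EReal.coe_lt_coe_iff]; linarith))
  obtain ⟨l, hl, hA⟩ := mem_E_iff.1 hmem
  refine mem_E_iff.2 ⟨l, hl, ?_⟩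
  rwa [show A α μ (fun ω => X ω + c) y l = A α μ X (y - c) l from
    lintegral_congr fun ω => by rw [show X ω + c - y = X ω - (y - c) by ring]]

lemma Q_mul_const_le {κ : ℝ} (hκ : 0 < κ) {r : ℝ} (hr : Q α μ X p ≤ r) :
    Q α μ (fun ω => κ * X ω) p ≤ (κ * r : ℝ) := by
  refine Q_le_of_forall_gt fun y hy => ?_
  have hmem : y / κ ∈ E α μ X p := mem_E_of_Q_lt (hr.trans_lt (by
    rw [EReal.coe_lt_coe_iff, lt_div_iff₀ hκ]; linarith))
  obtain ⟨l, hl, hA⟩ := mem_E_iff.1 hmem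
  refine mem_E_iff.2 ⟨l / κ, by positivity, ?_⟩
  rwa [show A α μ (fun ω => κ * X ω) y (l / κ) = A α μ X (y / κ) l from
    lintegral_congr fun ω => by
      rw [show l / κ * (κ * X ω - y) = l * (X ω - y / κ) by field_simp]]

/-- With the multiplier `l m / (l + m)`, the argument for `X + Y` is the convex combination, with
weights `m / (l + m)` and `l / (l + m)`, of the arguments for `X` and `Y`. Convexity of `h α` then
bounds the moment by an average of two numbers below `p`. -/
lemma Q_add_le {X Y : Ω → ℝ} (hX : Measurable X) (hα : 1 ≤ α) {r s : ℝ}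
    (hr : Q α μ X p ≤ r) (hs : Q α μ Y p ≤ s) (hp : 0 < p) :
    Q α μ (fun ω => X ω + Y ω) p ≤ (r + s : ℝ) := by
  refine Q_le_of_forall_gt fun z hz => ?_
  -- The slack is split evenly, so that `(r + d) + (s + d) = z`.
  set d := (z - (r + s)) / 2 with hd
  have hx : r + d ∈ E α μ X p := mem_E_of_Q_lt (hr.trans_lt (by
    rw [EReal.coe_lt_coe_iff]; linarith))
  have hy : s + d ∈ E α μ Y p := mem_E_of_Q_lt (hs.trans_lt (by
    rw [EReal.coe_lt_coe_iff]; linarith))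
  obtain ⟨l, hl, hA⟩ := mem_E_iff.1 hx
  obtain ⟨m, hm, hB⟩ := mem_E_iff.1 hy
  have hlm : 0 < l + m := by positivity
  refine mem_E_iff.2 ⟨l * m / (l + m), by positivity, ?_⟩
  set a := m / (l + m)
  set b := l / (l + m)
  have ha : 0 < a := by positivity
  have hb : 0 < b := by positivity
  have hab : a + b = 1 := by simp only [a, b]; field_simp; ring
  have hpt : ∀ ω, ENNReal.ofReal (h α (l * m / (l + m) * (X ω + Y ω - z))) ≤
      ENNReal.ofReal a * ENNReal.ofReal (h α (l * (X ω - (r + d)))) +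
      ENNReal.ofReal b * ENNReal.ofReal (h α (m * (Y ω - (s + d)))) := by
    intro ω
    rw [← ENNReal.ofReal_mul ha.le, ← ENNReal.ofReal_mul hb.le, ← ENNReal.ofReal_add
      (mul_nonneg ha.le (h_nonneg _ _)) (mul_nonneg hb.le (h_nonneg _ _))]
    refine ENNReal.ofReal_le_ofReal ?_
    convert! (convexOn_h hα).2 (mem_univ (l * (X ω - (r + d)))) (mem_univ (m * (Y ω - (s + d))))
      ha.le hb.le hab using 2
    simp only [a, b, hd, smul_eq_mul]
    field_simp
    ring
  have hp0 : ENNReal.ofReal p ≠ 0 := (ENNReal.ofReal_pos.2 hp).ne'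
  calc A α μ (fun ω => X ω + Y ω) z (l * m / (l + m))
      ≤ ∫⁻ ω, ENNReal.ofReal a * ENNReal.ofReal (h α (l * (X ω - (r + d)))) +
          ENNReal.ofReal b * ENNReal.ofReal (h α (m * (Y ω - (s + d)))) ∂μ := lintegral_mono hpt
    _ = ENNReal.ofReal a * A α μ X (r + d) l + ENNReal.ofReal b * A α μ Y (s + d) m := by
        rw [lintegral_add_left (by fun_prop), lintegral_const_mul' _ _ ENNReal.ofReal_ne_top,
          lintegral_const_mul' _ _ ENNReal.ofReal_ne_top]
        rfl
    _ < ENNReal.ofReal a * ENNReal.ofReal p + ENNReal.ofReal b * ENNReal.ofReal p := by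
        refine ENNReal.add_lt_add ?_ ?_
        · exact (ENNReal.mul_lt_mul_iff_right (by simpa using ha) ENNReal.ofReal_ne_top).2 hA
        · exact (ENNReal.mul_lt_mul_iff_right (by simpa using hb) ENNReal.ofReal_ne_top).2 hB
    _ = ENNReal.ofReal p := by
        rw [← add_mul, ← ENNReal.ofReal_add ha.le hb.le, hab, ENNReal.ofReal_one, one_mul]

end Basic

/-! ### The change of level in which `Q` is concave. -/

/-- The transform of the level `q` in which the bound `Q α μ X q` is concave. -/
noncomputable def levelParam (α : ℝ≥0∞) (q : ℝ) : ℝ :=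
  if α = ∞ then Real.log (1 / q) else q ^ (-(1 / α.toReal))

/-- The interval of the values `levelParam α q` with `0 < q < 1`. -/
def levelRange (α : ℝ≥0∞) : Set ℝ := if α = ∞ then Ioi 0 else Ioi 1

section LevelParam

variable {α : ℝ≥0∞} {q r s : ℝ}

lemma isOpen_levelRange : IsOpen (levelRange α) := by
  unfold levelRange
  split_ifs <;> exact isOpen_Ioi

lemma convex_levelRange : Convex ℝ (levelRange α) := by
  unfold levelRange
  split_ifs <;> exact convex_Ioi _

lemma levelParam_mem (hα : α ≠ 0) (hq : q ∈ Ioo (0 : ℝ) 1) : levelParam α q ∈ levelRange α := by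
  unfold levelParam levelRange
  split_ifs with h1
  · exact Real.log_pos (one_lt_one_div hq.1 hq.2)
  · have := ENNReal.toReal_pos hα h1
    exact Real.one_lt_rpow_of_pos_of_lt_one_of_neg hq.1 hq.2 (by simpa using this)

lemma exists_levelParam_eq (hα : α ≠ 0) (hs : s ∈ levelRange α) :
    ∃ q ∈ Ioo (0 : ℝ) 1, levelParam α q = s := by
  unfold levelParam levelRange at *
  split_ifs at * with h1
  · refine ⟨Real.exp (-s), ⟨Real.exp_pos _, by simpa using hs⟩, ?_⟩
    simp [← Real.exp_neg]
  · have ha := ENNReal.toReal_pos hα h1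
    have hs0 : 0 < s := one_pos.trans hs
    refine ⟨s ^ (-α.toReal), ⟨by positivity, Real.rpow_lt_one_of_one_lt_of_neg hs (by linarith)⟩, ?_⟩
    rw [← Real.rpow_mul hs0.le]
    field_simp
    simp

lemma levelParam_lt (hα : α ≠ 0) (hq : 0 < q) (hqr : q < r) : levelParam α r < levelParam α q := by
  unfold levelParam
  have hr : 0 < r := hq.trans hqr
  split_ifs with h1
  · exact Real.log_lt_log (by positivity) (one_div_lt_one_div_of_lt hq hqr)
  · have ha := ENNReal.toReal_pos hα h1
    exact Real.rpow_lt_rpow_of_neg hq hqr (by simpa using ha)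

lemma continuousOn_levelParam : ContinuousOn (levelParam α) (Ioo 0 1) := by
  unfold levelParam
  have hne : ∀ q ∈ Ioo (0 : ℝ) 1, q ≠ 0 := fun q hq => hq.1.ne'
  split_ifs with h1
  · exact ContinuousOn.log (continuousOn_const.div continuousOn_id hne)
      fun q hq => one_div_ne_zero (hne q hq)
  · exact continuousOn_id.rpow_const fun q hq => Or.inl (hne q hq)

end LevelParam

/-! ### Affine structure of `E`: finiteness, concavity, continuity, strict decrease, sensitivity. -/

section Finiteness

variable {Ω : Type*} [MeasurableSpace Ω] {μ : Measure Ω} {X : Ω → ℝ} {α : ℝ≥0∞} {p q x y : ℝ}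

/-- The crude bound `(X - t)_+ ≤ 2 max(X_+, |t|)` works for every exponent `a > 0`, including `a <
1`. -/
lemma lintegral_posPart_sub_lt_top [IsProbabilityMeasure μ] {a : ℝ} (ha : 0 < a)
    (hX : ∫⁻ ω, ENNReal.ofReal ((max 0 (X ω)) ^ a) ∂μ < ∞) (t : ℝ) :
    ∫⁻ ω, ENNReal.ofReal ((max 0 (X ω - t)) ^ a) ∂μ < ∞ := by
  have hpt : ∀ ω, ENNReal.ofReal ((max 0 (X ω - t)) ^ a) ≤
      ENNReal.ofReal (2 ^ a) * (ENNReal.ofReal ((max 0 (X ω)) ^ a) + ENNReal.ofReal (|t| ^ a)) := by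
    intro ω
    rw [← ENNReal.ofReal_add (by positivity) (by positivity), ← ENNReal.ofReal_mul (by positivity)]
    refine ENNReal.ofReal_le_ofReal ?_
    have h1 : max 0 (X ω - t) ≤ 2 * max (max 0 (X ω)) |t| := by
      refine max_le (by positivity) ?_
      linarith [neg_abs_le t, le_max_left (max 0 (X ω)) |t|, le_max_right (max 0 (X ω)) |t|,
        le_max_right 0 (X ω)]
    calc (max 0 (X ω - t)) ^ a ≤ (2 * max (max 0 (X ω)) |t|) ^ a := by gcongr
      _ = 2 ^ a * (max (max 0 (X ω)) |t|) ^ a := Real.mul_rpow (by norm_num) (by positivity)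
      _ ≤ 2 ^ a * ((max 0 (X ω)) ^ a + |t| ^ a) := by
        gcongr
        rcases max_cases (max 0 (X ω)) |t| with ⟨he, _⟩ | ⟨he, _⟩ <;> rw [he]
        · linarith [Real.rpow_nonneg (abs_nonneg t) a]
        · linarith [Real.rpow_nonneg (le_max_left 0 (X ω)) a]
  refine (lintegral_mono hpt).trans_lt ?_
  rw [lintegral_const_mul' _ _ ENNReal.ofReal_ne_top, lintegral_add_right _ measurable_const]
  refine ENNReal.mul_lt_top ENNReal.ofReal_lt_top (ENNReal.add_lt_top.2 ⟨hX, ?_⟩)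
  simp

/-- The substitution `l = α / (x - t)` is a bijection between `t < x` and `l > 0`. It separates `x`
from the moment of `X`, which is what makes the ray end points affine, and it links `A` to the
kernels `g α t`. -/
lemma A_div_sub (h0 : α ≠ 0) (h1 : α ≠ ∞) {t : ℝ} (ht : t < x) :
    A α μ X x (α.toReal / (x - t)) =
      ENNReal.ofReal ((x - t) ^ (-α.toReal)) *
        ∫⁻ ω, ENNReal.ofReal ((max 0 (X ω - t)) ^ α.toReal) ∂μ := by
  have ha := ENNReal.toReal_pos h0 h1
  have hxt : 0 < x - t := sub_pos.2 ht
  rw [← lintegral_const_mul' _ _ ENNReal.ofReal_ne_top]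
  refine lintegral_congr fun ω => ?_
  rw [← ENNReal.ofReal_mul (by positivity), h_of_ne h0 h1]
  congr 1
  have he : 1 + α.toReal / (x - t) * (X ω - x) / α.toReal = (x - t)⁻¹ * (X ω - t) := by
    field_simp
    ring
  rw [he, show max 0 ((x - t)⁻¹ * (X ω - t)) = (x - t)⁻¹ * max 0 (X ω - t) by
      rw [mul_max_of_nonneg _ _ (by positivity), mul_zero],
    Real.mul_rpow (by positivity) (by positivity), Real.inv_rpow hxt.le, Real.rpow_neg hxt.le]

lemma A_top_eq (x l : ℝ) : A ∞ μ X x l =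
    ENNReal.ofReal (Real.exp (-(l * x))) * ∫⁻ ω, ENNReal.ofReal (Real.exp (l * X ω)) ∂μ := by
  rw [← lintegral_const_mul' _ _ ENNReal.ofReal_ne_top]
  refine lintegral_congr fun ω => ?_
  rw [← ENNReal.ofReal_mul (by positivity), h_top, ← Real.exp_add]
  congr 2
  ring

lemma mem_Lam_of_A_lt_top {l : ℝ} (hl : 0 < l) (hA : A ∞ μ X x l < ∞) : l ∈ Lam μ X := by
  refine ⟨hl, ?_⟩
  by_contra hcon
  rw [A_top_eq, not_lt_top_iff.1 hcon, ENNReal.mul_top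
    (ENNReal.ofReal_pos.2 (Real.exp_pos _)).ne'] at hA
  exact lt_irrefl _ hA

/-- The set `E` is a union of open rays with end points affine in the transformed level. -/
theorem exists_affine [IsProbabilityMeasure μ] (hα : α ≠ 0) (hX : MemX α μ X) :
    ∃ (I : Set ℝ) (a b : ℝ → ℝ), I.Nonempty ∧
      ∀ q ∈ Ioo (0 : ℝ) 1, ∀ x, x ∈ E α μ X q ↔ ∃ i ∈ I, a i + b i * levelParam α q < x := by
  rcases eq_or_ne α ∞ with rfl | h1
  -- Rays indexed by `l`: `e^(-l x) M(l) < q` means `x > (log M(l) + log (1/q)) / l`.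
  · let M : ℝ → ℝ := fun l => (∫⁻ ω, ENNReal.ofReal (Real.exp (l * X ω)) ∂μ).toReal
    have key : ∀ q ∈ Ioo (0 : ℝ) 1, ∀ x, ∀ l ∈ Lam μ X,
        (A ∞ μ X x l < ENNReal.ofReal q ↔
          l⁻¹ * Real.log (M l) + l⁻¹ * levelParam ∞ q < x) := by
      rintro q ⟨hq, _⟩ x l ⟨hl, hfin⟩
      have hM0 : ∫⁻ ω, ENNReal.ofReal (Real.exp (l * X ω)) ∂μ ≠ 0 := by
        have hXm := hX.1
        rw [← pos_iff_ne_zero, lintegral_pos_iff_support (by fun_prop)]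
        have : Function.support (fun ω => ENNReal.ofReal (Real.exp (l * X ω))) = univ := by
          ext ω; simp [Real.exp_pos]
        simp [this]
      have hM : 0 < M l := ENNReal.toReal_pos hM0 hfin.ne
      rw [A_top_eq, ← ENNReal.ofReal_toReal hfin.ne, ← ENNReal.ofReal_mul (by positivity),
        ENNReal.ofReal_lt_ofReal_iff hq]
      change Real.exp (-(l * x)) * M l < q ↔ _
      rw [← Real.log_lt_log_iff (by positivity) hq, Real.log_mul (by positivity) hM.ne',
        Real.log_exp, levelParam, if_pos rfl, one_div, Real.log_inv, ← mul_add,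
        inv_mul_lt_iff₀ hl]
      constructor <;> intro _ <;> linarith
    refine ⟨Lam μ X, fun l => l⁻¹ * Real.log (M l), fun l => l⁻¹, hX.2.2 rfl, fun q hq x => ?_⟩
    rw [mem_E_iff]
    constructor
    · rintro ⟨l, hl, hA⟩
      have hL : l ∈ Lam μ X := mem_Lam_of_A_lt_top hl (hA.trans ENNReal.ofReal_lt_top)
      exact ⟨l, hL, (key q hq x l hL).1 hA⟩
    · rintro ⟨l, hL, hlt⟩
      exact ⟨l, hL.1, (key q hq x l hL).2 hlt⟩
  -- Rays indexed by all real `t`: for `t < x`, `(x - t)^(-α) M(t) < q` means `x > t + M(t)^(1/α)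
  -- q^(-1/α)`.
  · have ha := ENNReal.toReal_pos hα h1
    let M : ℝ → ℝ := fun t => (∫⁻ ω, ENNReal.ofReal ((max 0 (X ω - t)) ^ α.toReal) ∂μ).toReal
    have hM : ∀ t, 0 ≤ M t := fun t => ENNReal.toReal_nonneg
    have key : ∀ q ∈ Ioo (0 : ℝ) 1, ∀ x t, t < x →
        (A α μ X x (α.toReal / (x - t)) < ENNReal.ofReal q ↔
          t + (M t) ^ (1 / α.toReal) * levelParam α q < x) := by
      rintro q ⟨hq, _⟩ x t ht
      have hxt : 0 < x - t := sub_pos.2 ht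
      have hfin := lintegral_posPart_sub_lt_top ha (hX.2.1 hα h1) t
      rw [A_div_sub hα h1 ht, ← ENNReal.ofReal_toReal hfin.ne,
        ← ENNReal.ofReal_mul (by positivity), ENNReal.ofReal_lt_ofReal_iff hq]
      change (x - t) ^ (-α.toReal) * M t < q ↔ _
      rw [levelParam, if_neg h1, Real.rpow_neg hxt.le, inv_mul_lt_iff₀ (by positivity),
        Real.rpow_neg hq.le, ← div_eq_mul_inv, ← lt_sub_iff_add_lt', div_lt_iff₀ (by positivity),
        ← Real.rpow_lt_rpow_iff (hM t) (by positivity) (one_div_pos.2 ha),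
        Real.mul_rpow (by positivity) hq.le, ← Real.rpow_mul hxt.le, mul_one_div_cancel ha.ne',
        Real.rpow_one]
    refine ⟨univ, fun t => t, fun t => (M t) ^ (1 / α.toReal), univ_nonempty, fun q hq x => ?_⟩
    rw [mem_E_iff]
    constructor
    · rintro ⟨l, hl, hA⟩
      have ht : x - α.toReal / l < x := by linarith [div_pos ha hl]
      refine ⟨x - α.toReal / l, mem_univ _, (key q hq x _ ht).1 ?_⟩
      rwa [show α.toReal / (x - (x - α.toReal / l)) = l by field_simp; simp [ha.ne']]
    · rintro ⟨t, -, hlt⟩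
      have hφ : 0 ≤ levelParam α q := by
        rw [levelParam, if_neg h1]
        exact Real.rpow_nonneg hq.1.le _
      -- The slope and the parameter are nonnegative, so lying on the ray already forces `t < x`,
      -- and `t` gives an admissible multiplier.
      have ht : t < x := lt_of_le_of_lt
        (le_add_of_nonneg_right (mul_nonneg (Real.rpow_nonneg (hM t) _) hφ)) hlt
      exact ⟨_, div_pos ha (sub_pos.2 ht), (key q hq x t ht).2 hlt⟩

lemma exists_lt_measure_ge [IsProbabilityMeasure μ] (hX : Measurable X) {c : ℝ≥0∞} (hc : c < 1) :
    ∃ x : ℝ, c < μ {ω | x ≤ X ω} := by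
  have := Measure.isProbabilityMeasure_map (μ := μ) hX.aemeasurable
  have hlim := tendsto_measure_Ici_atBot (μ.map X)
  rw [measure_univ] at hlim
  obtain ⟨x, hx⟩ := (hlim.eventually_const_lt hc).exists
  rw [Measure.map_apply hX measurableSet_Ici] at hx
  exact ⟨x, hx⟩

lemma exists_measure_ge_lt [IsProbabilityMeasure μ] (hX : Measurable X) {c : ℝ≥0∞} (hc : 0 < c) :
    ∃ x : ℝ, μ {ω | x ≤ X ω} < c := by
  have hlim := tendsto_measure_iInter_atTop (μ := μ) (s := fun n : ℕ => {ω | (n : ℝ) ≤ X ω})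
    (fun n => (measurableSet_le measurable_const hX).nullMeasurableSet)
    (fun m n hmn ω (hω : (n : ℝ) ≤ X ω) =>
      show (m : ℝ) ≤ X ω from (Nat.cast_le.2 hmn).trans hω) ⟨0, measure_ne_top _ _⟩
  have hempty : ⋂ n : ℕ, {ω | (n : ℝ) ≤ X ω} = ∅ := by
    refine eq_empty_of_forall_notMem fun ω hω => ?_
    obtain ⟨n, hn⟩ := exists_nat_gt (X ω)
    exact not_le.2 hn (mem_iInter.1 hω n)
  rw [hempty, measure_empty] at hlim
  obtain ⟨n, hn⟩ := (hlim.eventually_lt_const hc).exists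
  exact ⟨n, hn⟩

/-- An ordinary quantile bounds `Q` from below. From above, `E` is nonempty: tails vanish if `α =
0`, and otherwise `E` contains a ray. -/
theorem exists_Q_eq_coe [IsProbabilityMeasure μ] (hX : MemX α μ X) (hq : q ∈ Ioo (0 : ℝ) 1) :
    ∃ r : ℝ, Q α μ X q = r := by
  have hbot : Q α μ X q ≠ ⊥ := by
    obtain ⟨x, hx⟩ := exists_lt_measure_ge hX.1 (μ := μ) (c := ENNReal.ofReal q)
      (ENNReal.ofReal_lt_one.2 hq.2)
    exact ne_bot_of_le_ne_bot (EReal.coe_ne_bot x) (le_Q_of_le_measure hX.1 hx.le)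
  have htop : Q α μ X q ≠ ⊤ := by
    have : ∃ x, x ∈ E α μ X q := by
      rcases eq_or_ne α 0 with rfl | hα
      · simp_rw [mem_E_zero_iff hX.1]
        exact exists_measure_ge_lt hX.1 (ENNReal.ofReal_pos.2 hq.1)
      · obtain ⟨I, a, b, ⟨i, hi⟩, hE⟩ := exists_affine hα hX
        exact ⟨a i + b i * levelParam α q + 1, (hE q hq _).2 ⟨i, hi, by linarith⟩⟩
    obtain ⟨x, hx⟩ := this
    exact ne_top_of_le_ne_top (EReal.coe_ne_top x) (Q_le hx)
  exact ⟨_, (EReal.coe_toReal htop hbot).symm⟩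

theorem exists_concaveOn [IsProbabilityMeasure μ] (hα : α ≠ 0) (hX : MemX α μ X) :
    ∃ f : ℝ → ℝ, ConcaveOn ℝ (levelRange α) f ∧
      ∀ q ∈ Ioo (0 : ℝ) 1, Q α μ X q = (f (levelParam α q) : ℝ) := by
  obtain ⟨I, a, b, hI, hE⟩ := exists_affine hα hX
  choose! r hr using fun q (hq : q ∈ Ioo (0 : ℝ) 1) => exists_Q_eq_coe hX hq
  have hglb : ∀ q ∈ Ioo (0 : ℝ) 1,
      IsGLB ((fun i => a i + b i * levelParam α q) '' I) (r q) := by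
    refine fun q hq => ⟨?_, fun c hc => ?_⟩
    · rintro _ ⟨i, hi, rfl⟩
      rw [← EReal.coe_le_coe_iff, ← hr q hq]
      exact Q_le_of_forall_gt fun y hy => (hE q hq y).2 ⟨i, hi, hy⟩
    · rw [← EReal.coe_le_coe_iff, ← hr q hq]
      refine le_Q fun x hx => ?_
      obtain ⟨i, hi, hlt⟩ := (hE q hq x).1 hx
      exact EReal.coe_le_coe_iff.2 ((hc ⟨i, hi, rfl⟩).trans hlt.le)
  let f : ℝ → ℝ := fun s => sInf ((fun i => a i + b i * s) '' I)
  have hf : ∀ q ∈ Ioo (0 : ℝ) 1, f (levelParam α q) = r q := fun q hq =>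
    (hglb q hq).csInf_eq (hI.image _)
  -- The real `sInf` is meaningful only for sets bounded below; surjectivity of `levelParam` onto
  -- its range carries this from levels `q` to every `s`.
  have hglb' : ∀ s ∈ levelRange α, IsGLB ((fun i => a i + b i * s) '' I) (f s) := by
    intro s hs
    obtain ⟨q, hq, rfl⟩ := exists_levelParam_eq hα hs
    rw [hf q hq]
    exact hglb q hq
  refine ⟨f, ⟨convex_levelRange, fun s hs t ht c d hc hd hcd => ?_⟩, fun q hq => ?_⟩
  · refine (hglb' _ (convex_levelRange hs ht hc hd hcd)).2 ?_
    rintro _ ⟨i, hi, rfl⟩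
    have h1 := (hglb' s hs).1 ⟨i, hi, rfl⟩
    have h2 := (hglb' t ht).1 ⟨i, hi, rfl⟩
    simp only [smul_eq_mul] at *
    calc c * f s + d * f t ≤ c * (a i + b i * s) + d * (a i + b i * t) := by gcongr
      _ = a i + b i * (c * s + d * t) := by linear_combination a i * hcd
  · rw [hr q hq, hf q hq]

theorem continuousOn_Q [IsProbabilityMeasure μ] (hα : α ≠ 0) (hX : MemX α μ X) :
    ContinuousOn (fun q => Q α μ X q) (Ioo 0 1) := by
  obtain ⟨f, hf, hQ⟩ := exists_concaveOn hα hX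
  refine ContinuousOn.congr ?_ hQ
  exact continuous_coe_real_ereal.comp_continuousOn
    ((hf.continuousOn isOpen_levelRange).comp continuousOn_levelParam
      fun q hq => levelParam_mem hα hq)

/-- If `Q` takes the same value at two levels, then this value bounds `X` from above. -/
lemma le_of_Q_eq [IsProbabilityMeasure μ] (hα : α ≠ 0) (hX : MemX α μ X)
    (hp : p ∈ Ioo (0 : ℝ) 1) (hq : q ∈ Ioo (0 : ℝ) 1) (hqp : q < p)
    (heq : Q α μ X q = Q α μ X p) (hx : 0 < μ {ω | x ≤ X ω}) : (x : EReal) ≤ Q α μ X p := by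
  obtain ⟨f, hf, hQ⟩ := exists_concaveOn hα hX
  obtain ⟨m, -, hm⟩ := ENNReal.lt_iff_exists_real_btwn.1 hx
  have hm0' : 0 < m := ENNReal.ofReal_pos.1 hm.1
  set s := min m (q / 2) with hs
  have hs0 : 0 < s := lt_min hm0' (half_pos hq.1)
  have hsq : s < q := (min_le_right _ _).trans_lt (half_lt_self hq.1)
  have hs1 : s ∈ Ioo (0 : ℝ) 1 := ⟨hs0, hsq.trans hq.2⟩
  -- The level `s` is at most `m ≤ P(X ≥ x)`, so its quantile reaches `x`; it is also below `q`, as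
  -- the slope comparison requires.
  have hxs : (x : EReal) ≤ Q α μ X s := le_Q_of_le_measure hX.1
    ((ENNReal.ofReal_le_ofReal (min_le_left _ _)).trans hm.2.le)
  refine hxs.trans ?_
  have h1 := levelParam_lt hα hq.1 hqp
  have h2 := levelParam_lt hα hs0 hsq
  -- The parameters of `p`, `q`, `s` increase in this order. The slope over the first pair is zero,
  -- so over the second it is nonpositive.
  have hslope := hf.slope_anti_adjacent (levelParam_mem hα hp) (levelParam_mem hα hs1) h1 h2
  rw [hQ q hq, hQ p hp, EReal.coe_eq_coe_iff] at heq
  rw [heq, sub_self, zero_div, div_le_iff₀ (sub_pos.2 h2), zero_mul] at hslope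
  rw [hQ s hs1, hQ p hp, EReal.coe_le_coe_iff]
  linarith

/-- If `Q` had a common value `r` at levels `q < p`, then `X ≤ r` almost surely and `P(X = r) ≤ p_*
≤ q < p`, which puts `r` in `E` at level `p`. But that set is open, so its infimum would be below
`r`. -/
theorem strictAntiOn_Q [IsProbabilityMeasure μ] (hα : α ≠ 0) (hX : MemX α μ X) :
    StrictAntiOn (fun q => Q α μ X q)
      {q | q ∈ Ioo (0 : ℝ) 1 ∧ pStar μ X ≤ ENNReal.ofReal q} := by
  rintro q ⟨hq, hqs⟩ p ⟨hp, -⟩ hqp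
  refine lt_of_le_of_ne (Q_anti hqp.le) fun heq => ?_
  have hle := fun x => le_of_Q_eq (x := x) hα hX hp hq hqp heq.symm
  obtain ⟨r, hr⟩ := exists_Q_eq_coe hX hp
  rw [hr] at hle
  have hstar : xStar μ X ≤ r := by
    refine sSup_le ?_
    rintro _ ⟨x, hx, rfl⟩
    rw [EReal.coe_le_coe_iff]
    refine le_of_forall_sub_le fun ε hε => EReal.coe_le_coe_iff.1 (hle _ ?_)
    -- A support point may have a null ray `[x, ∞)`, whereas `[x - ε, ∞)` is a neighbourhood and has
    -- positive mass.
    have := (Measure.mem_support_iff_forall x).1 hx (Ici (x - ε)) (Ici_mem_nhds (by linarith))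
    rwa [Measure.map_apply hX.1 measurableSet_Ici] at this
  have hae : ∀ᵐ ω ∂μ, (X ω : EReal) ≤ xStar μ X := by
    have := ae_of_ae_map hX.1.aemeasurable (Measure.support_mem_ae (μ := μ.map X))
    filter_upwards [this] with ω hω
    exact le_sSup ⟨X ω, hω, rfl⟩
  have hmass : μ {ω | X ω = r} ≤ pStar μ X := by
    refine measure_mono_ae ?_
    filter_upwards [hae] with ω hω (heqω : X ω = r)
    change (X ω : EReal) = xStar μ X
    exact le_antisymm hω (by rw [heqω]; exact hstar)
  have hmem : r ∈ E α μ X p := by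
    refine mem_E_of_ae_le hX.1 (hae.mono fun ω hω => EReal.coe_le_coe_iff.1 (hω.trans hstar)) ?_
    exact (hmass.trans hqs).trans_lt ((ENNReal.ofReal_lt_ofReal_iff hp.1).2 hqp)
  obtain ⟨I, a, b, -, hE⟩ := exists_affine hα hX
  obtain ⟨i, hi, hlt⟩ := (hE p hp r).1 hmem
  obtain ⟨y, hy1, hy2⟩ := exists_between hlt
  have hy : Q α μ X p ≤ y := Q_le ((hE p hp y).2 ⟨i, hi, hy1⟩)
  rw [hr, EReal.coe_le_coe_iff] at hy
  linarith

lemma exists_pos_lt_measure_ge {c : ℝ≥0∞} (hc : c < μ {ω | 0 < X ω}) :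
    ∃ x : ℝ, 0 < x ∧ c < μ {ω | x ≤ X ω} := by
  have hU : {ω | 0 < X ω} = ⋃ n : ℕ, {ω | 1 / ((n : ℝ) + 1) ≤ X ω} := by
    ext ω
    simp only [mem_ofPred_eq, mem_iUnion]
    constructor
    · intro hω
      obtain ⟨n, hn⟩ := exists_nat_one_div_lt hω
      exact ⟨n, hn.le⟩
    · rintro ⟨n, hn⟩
      exact lt_of_lt_of_le (by positivity) hn
  have hmono : Monotone fun n : ℕ => {ω | 1 / ((n : ℝ) + 1) ≤ X ω} :=
    fun m n hmn ω (hω : 1 / ((m : ℝ) + 1) ≤ X ω) =>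
      show 1 / ((n : ℝ) + 1) ≤ X ω from (one_div_le_one_div_of_le (by positivity)
        (by gcongr)).trans hω
  rw [hU, hmono.measure_iUnion, lt_iSup_iff] at hc
  obtain ⟨n, hn⟩ := hc
  exact ⟨_, by positivity, hn⟩

/-- If `Q ≤ 0` at `p`, then, since `X ≥ 0` keeps `Q` nonnegative at the higher level `(p + 1) / 2`,
both values vanish. `le_of_Q_eq` then excludes mass on `[x, ∞)` for `x > 0`. -/
theorem Q_pos [IsProbabilityMeasure μ] (hα : α ≠ 0) (hX : MemX α μ X) (hp : p ∈ Ioo (0 : ℝ) 1)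
    (h0 : ∀ᵐ ω ∂μ, 0 ≤ X ω) (hpos : 0 < μ {ω | 0 < X ω}) : 0 < Q α μ X p := by
  by_contra hcon
  rw [not_lt] at hcon
  obtain ⟨x, hx0, hx⟩ := exists_pos_lt_measure_ge hpos
  have hp' : (p + 1) / 2 ∈ Ioo (0 : ℝ) 1 := ⟨by linarith [hp.1], by linarith [hp.2]⟩
  have hlt : p < (p + 1) / 2 := by linarith [hp.2]
  have hge : (0 : EReal) ≤ Q α μ X ((p + 1) / 2) := by
    have h1 : μ {ω | 0 ≤ X ω} = 1 := by
      rw [← measure_univ (μ := μ)]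
      exact measure_congr (eventuallyEq_univ.2 h0)
    exact le_Q_of_le_measure (x := 0) hX.1 (by rw [h1]; exact ENNReal.ofReal_le_one.2 hp'.2.le)
  have hle := Q_anti (α := α) (μ := μ) (X := X) hlt.le
  have := le_of_Q_eq hα hX hp' hp hlt (le_antisymm (hcon.trans hge) hle) hx
  have hx' : (x : EReal) ≤ 0 := this.trans (hle.trans hcon)
  exact absurd (EReal.coe_le_coe_iff.1 hx') (not_le.2 hx0)

theorem Q_zero_pos (hX : Measurable X)
    (hpos : ENNReal.ofReal p < μ {ω | 0 < X ω}) : 0 < Q 0 μ X p := by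
  obtain ⟨x, hx0, hx⟩ := exists_pos_lt_measure_ge hpos
  exact lt_of_lt_of_le (EReal.coe_lt_coe_iff.2 hx0) (le_Q_of_le_measure hX hx.le)

end Finiteness

/-! ### Stochastic dominance and mixtures of the kernels `g`. -/

section Dominance

/-- Since `rpow` with exponent `0` equals `1`, this form also covers the indicator kernel at `β =
0`, and the mixture integrals need no separate case. -/
lemma g_eq_ite {β : ℝ≥0∞} (hβ : β ≠ ∞) (t u : ℝ) :
    g β t u = if t < u then (u - t) ^ β.toReal else 0 := by
  unfold g
  rcases eq_or_ne β 0 with rfl | h0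
  · simp
  · rw [if_neg h0, if_neg hβ]
    split_ifs with htu
    · rw [max_eq_right (by linarith)]
    · rw [max_eq_left (by linarith), Real.zero_rpow (ENNReal.toReal_pos h0 hβ).ne']

lemma g_top (t u : ℝ) : g ∞ t u = Real.exp (u / t) := by simp [g]

lemma g_nonneg (α : ℝ≥0∞) (t u : ℝ) : 0 ≤ g α t u := by
  unfold g
  split_ifs <;> positivity

/-- Scaling of the truncated Beta integral. -/
lemma lintegral_Ioi_rpow_mul_g {β : ℝ≥0∞} (hβ : β ≠ ∞) {a : ℝ} (t : ℝ) {u : ℝ} (hu : t < u) :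
    ∫⁻ s in Ioi t, ENNReal.ofReal ((s - t) ^ (a - 1)) * ENNReal.ofReal (g β s u) =
      ENNReal.ofReal ((u - t) ^ (a + β.toReal)) *
        ∫⁻ r in Ioo (0 : ℝ) 1, ENNReal.ofReal (r ^ (a - 1) * (1 - r) ^ β.toReal) := by
  have hut : 0 < u - t := sub_pos.2 hu
  -- The kernel vanishes for `s ≥ u`; the substitution `s = t + (u - t) r` then maps `(0, 1)` onto
  -- the remaining interval.
  have himage : (fun r : ℝ => t + (u - t) * r) '' Ioo 0 1 = Ioo t u := by
    rw [← Set.image_image (fun x => t + x) (fun x => (u - t) * x), Set.image_mul_left_Ioo hut,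
      Set.image_const_add_Ioo]
    simp
  have hsub : ∫⁻ s in Ioi t, ENNReal.ofReal ((s - t) ^ (a - 1)) * ENNReal.ofReal (g β s u) =
      ∫⁻ s in Ioo t u, ENNReal.ofReal ((s - t) ^ (a - 1) * (u - s) ^ β.toReal) := by
    rw [← lintegral_indicator measurableSet_Ioi, ← lintegral_indicator measurableSet_Ioo]
    refine lintegral_congr fun s => ?_
    by_cases hs : t < s
    · by_cases hsu : s < u
      · simp [indicator, hs, hsu, g_eq_ite hβ,
          ENNReal.ofReal_mul (Real.rpow_nonneg (sub_pos.2 hs).le (a - 1))]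
      · simp [indicator, hsu, g_eq_ite hβ]
    · simp [indicator, hs]
  rw [hsub, ← himage, lintegral_image_eq_lintegral_abs_deriv_mul (f' := fun _ => u - t)
    measurableSet_Ioo (fun r _ => ?_) (fun r _ s _ hrs => ?_),
    ← lintegral_const_mul' _ _ ENNReal.ofReal_ne_top]
  · refine setLIntegral_congr_fun measurableSet_Ioo fun r hr => ?_
    have hr1 : 0 < 1 - r := sub_pos.2 hr.2
    rw [← ENNReal.ofReal_mul (abs_nonneg _), ← ENNReal.ofReal_mul (by positivity), abs_of_pos hut]
    congr 1
    rw [show t + (u - t) * r - t = (u - t) * r by ring,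
      show u - (t + (u - t) * r) = (u - t) * (1 - r) by ring,
      Real.mul_rpow hut.le hr.1.le, Real.mul_rpow hut.le hr1.le, Real.rpow_add hut,
      Real.rpow_sub_one hut.ne']
    field_simp
  · exact (((hasDerivAt_id r).const_mul (u - t)).const_add t).hasDerivWithinAt.congr_deriv
      (mul_one _)
  · simpa [hut.ne'] using hrs

lemma lintegral_beta_lt_top {a b : ℝ} (ha : 0 < a) (hb : 0 ≤ b) :
    ∫⁻ r in Ioo (0 : ℝ) 1, ENNReal.ofReal (r ^ (a - 1) * (1 - r) ^ b) < ∞ := by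
  have hint : IntegrableOn (fun r : ℝ => r ^ (a - 1)) (Ioo 0 1) :=
    (intervalIntegral.integrableOn_Ioo_rpow_iff one_pos).2 (by linarith)
  refine lt_of_le_of_lt (setLIntegral_mono' measurableSet_Ioo fun r hr => ?_)
    hint.lintegral_lt_top
  refine ENNReal.ofReal_le_ofReal (mul_le_of_le_one_right (Real.rpow_nonneg hr.1.le _) ?_)
  exact Real.rpow_le_one (by linarith [hr.2]) (by linarith [hr.1]) hb

lemma lintegral_beta_ne_zero {a b : ℝ} :
    ∫⁻ r in Ioo (0 : ℝ) 1, ENNReal.ofReal (r ^ (a - 1) * (1 - r) ^ b) ≠ 0 := by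
  rw [← pos_iff_ne_zero, setLIntegral_pos_iff (by fun_prop)]
  have hsub : Ioo (0 : ℝ) 1 ⊆ Function.support
      (fun r : ℝ => ENNReal.ofReal (r ^ (a - 1) * (1 - r) ^ b)) ∩ Ioo 0 1 := by
    refine fun r hr => ⟨?_, hr⟩
    have hr0 := hr.1
    have hr1 : 0 < 1 - r := sub_pos.2 hr.2
    have : 0 < r ^ (a - 1) * (1 - r) ^ b := by positivity
    simpa using this
  exact lt_of_lt_of_le (by simp) (measure_mono hsub)

/-- Translation in the truncated Gamma integral. -/
lemma lintegral_exp_mul_g {β : ℝ≥0∞} (hβ : β ≠ ∞) (t u : ℝ) :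
    ∫⁻ s, ENNReal.ofReal (Real.exp (s / t)) * ENNReal.ofReal (g β s u) =
      ENNReal.ofReal (Real.exp (u / t)) *
        ∫⁻ r in Ioi (0 : ℝ), ENNReal.ofReal (r ^ β.toReal * Real.exp (-(r / t))) := by
  rw [← lintegral_indicator measurableSet_Ioi, ← lintegral_const_mul' _ _ ENNReal.ofReal_ne_top,
    ← lintegral_sub_left_eq_self _ u]
  refine lintegral_congr fun s => ?_
  by_cases hs : 0 < s
  · simp only [g_eq_ite hβ, sub_lt_self_iff, hs, if_true, sub_sub_cancel, indicator, mem_Ioi]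
    rw [← ENNReal.ofReal_mul (by positivity), ← ENNReal.ofReal_mul (by positivity), sub_div,
      sub_eq_add_neg, Real.exp_add]
    congr 1
    ring
  · simp [g_eq_ite hβ, hs]

lemma lintegral_gamma_lt_top {b t : ℝ} (hb : 0 ≤ b) (ht : 0 < t) :
    ∫⁻ r in Ioi (0 : ℝ), ENNReal.ofReal (r ^ b * Real.exp (-(r / t))) < ∞ := by
  have hint := integrableOn_rpow_mul_exp_neg_mul_rpow (p := 1) (s := b) (b := t⁻¹)
    (by linarith) one_pos (by positivity)
  refine lt_of_le_of_lt (le_of_eq ?_) hint.lintegral_lt_top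
  refine lintegral_congr fun r => ?_
  rw [Real.rpow_one]
  congr 3
  ring

lemma lintegral_gamma_ne_zero {b t : ℝ} :
    ∫⁻ r in Ioi (0 : ℝ), ENNReal.ofReal (r ^ b * Real.exp (-(r / t))) ≠ 0 := by
  rw [← pos_iff_ne_zero, setLIntegral_pos_iff (by fun_prop)]
  have hsub : Ioi (0 : ℝ) ⊆ Function.support
      (fun r : ℝ => ENNReal.ofReal (r ^ b * Real.exp (-(r / t)))) ∩ Ioi 0 := by
    refine fun r hr => ⟨?_, hr⟩
    have hr0 : 0 < r := hr
    have : 0 < r ^ b * Real.exp (-(r / t)) := by positivity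
    simpa using this
  exact lt_of_lt_of_le (by simp) (measure_mono hsub)

lemma measurable_g_left (β : ℝ≥0∞) (u : ℝ) : Measurable fun s => g β s u := by
  unfold g
  split_ifs
  · exact Measurable.ite measurableSet_Iio measurable_const measurable_const
  · fun_prop
  · fun_prop

/-- For `β ≤ α`, the functions `g α t` belong, up to a positive factor, to the class `H β`. -/
lemma exists_const_mul_g_mem_H {α β : ℝ≥0∞} (hβα : β ≤ α) {t : ℝ} (ht : t ∈ T α) :
    ∃ c : ℝ, 0 < c ∧ (fun u => c * g α t u) ∈ H β := by
  rcases hβα.eq_or_lt with rfl | hlt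
  · refine ⟨1, one_pos, fun u => by simpa using g_nonneg β t u, Measure.dirac t, fun u => ?_⟩
    classical
    rw [restrict_dirac, if_pos ht, lintegral_dirac]
    simp
  have hβ : β ≠ ∞ := hlt.ne_top
  have hT : T β = univ := by simp [T, hβ]
  -- The Beta or Gamma constant `C` is left unnormalised: any factor in `(0, ∞)` cancels when two
  -- means are compared.
  have finish : ∀ (C : ℝ≥0∞), C ≠ 0 → C < ∞ → ∀ ν : Measure ℝ,
      (∀ u, ∫⁻ s, ENNReal.ofReal (g β s u) ∂ν = ENNReal.ofReal (g α t u) * C) →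
      ∃ c : ℝ, 0 < c ∧ (fun u => c * g α t u) ∈ H β := by
    intro C hC0 hC1 ν hν
    refine ⟨C.toReal, ENNReal.toReal_pos hC0 hC1.ne,
      fun u => mul_nonneg ENNReal.toReal_nonneg (g_nonneg α t u), ν, fun u => ?_⟩
    rw [hT, Measure.restrict_univ, hν u, ENNReal.ofReal_mul ENNReal.toReal_nonneg,
      ENNReal.ofReal_toReal hC1.ne, mul_comm]
  rcases eq_or_ne α ∞ with rfl | hα
  · have ht0 : 0 < t := by simpa [T] using ht
    refine finish _ lintegral_gamma_ne_zero
      (lintegral_gamma_lt_top (b := β.toReal) ENNReal.toReal_nonneg ht0)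
      (volume.withDensity fun s => ENNReal.ofReal (Real.exp (s / t))) fun u => ?_
    rw [lintegral_withDensity_eq_lintegral_mul _ (by fun_prop)
      (measurable_g_left β u).ennreal_ofReal, g_top]
    exact lintegral_exp_mul_g hβ t u
  · have hab : β.toReal < α.toReal := (ENNReal.toReal_lt_toReal hβ hα).2 hlt
    refine finish _ lintegral_beta_ne_zero (lintegral_beta_lt_top (a := α.toReal - β.toReal)
      (b := β.toReal) (sub_pos.2 hab) ENNReal.toReal_nonneg)
      ((volume.restrict (Ioi t)).withDensity
        fun s => ENNReal.ofReal ((s - t) ^ (α.toReal - β.toReal - 1))) fun u => ?_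
    rw [lintegral_withDensity_eq_lintegral_mul _ (by fun_prop)
      (measurable_g_left β u).ennreal_ofReal]
    simp only [Pi.mul_apply]
    rcases lt_or_ge t u with htu | hut
    · rw [lintegral_Ioi_rpow_mul_g hβ t htu, g_eq_ite hα, if_pos htu, sub_add_cancel]
    · rw [g_eq_ite hα, if_neg hut.not_gt, ENNReal.ofReal_zero, zero_mul]
      rw [setLIntegral_congr_fun measurableSet_Ioi (g := 0) fun s (hs : t < s) => ?_]
      · simp
      · simp [g_eq_ite hβ, (hut.trans_lt hs).not_gt]

variable {Ω Ω' : Type*} [MeasurableSpace Ω] [MeasurableSpace Ω'] {μ : Measure Ω} {ν : Measure Ω'}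
  {X : Ω → ℝ} {Y : Ω' → ℝ} {α β : ℝ≥0∞} {p : ℝ}

lemma StochDom.lintegral_g_le (hdom : StochDom β μ X ν Y) (hβα : β ≤ α) {t : ℝ} (ht : t ∈ T α) :
    ∫⁻ ω, ENNReal.ofReal (g α t (X ω)) ∂μ ≤ ∫⁻ ω, ENNReal.ofReal (g α t (Y ω)) ∂ν := by
  obtain ⟨c, hc, hmem⟩ := exists_const_mul_g_mem_H hβα ht
  have hle := hdom _ hmem
  simp only [ENNReal.ofReal_mul hc.le] at hle
  rw [lintegral_const_mul' _ _ ENNReal.ofReal_ne_top,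
    lintegral_const_mul' _ _ ENNReal.ofReal_ne_top] at hle
  exact (ENNReal.mul_le_mul_iff_right (ENNReal.ofReal_pos.2 hc).ne' ENNReal.ofReal_ne_top).1 hle

lemma lintegral_g_zero (hX : Measurable X) (x : ℝ) :
    ∫⁻ ω, ENNReal.ofReal (g 0 x (X ω)) ∂μ = μ {ω | x < X ω} := by
  rw [← lintegral_indicator_one (measurableSet_lt measurable_const hX)]
  refine lintegral_congr fun ω => ?_
  by_cases hω : x < X ω <;> simp [g, hω]

theorem StochDom.Q_le_Q (hdom : StochDom β μ X ν Y) (hβα : β ≤ α) (hX : Measurable X)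
    (hY : Measurable Y) : Q α μ X p ≤ Q α ν Y p := by
  have hg := fun t (ht : t ∈ T α) => hdom.lintegral_g_le hβα ht
  rcases eq_or_ne α 0 with rfl | h0
  -- `g 0` detects `u > t`, while `h 0` detects `u ≥ 0`; passing to `y > x` bridges strict and
  -- nonstrict tails.
  · refine le_Q fun x hx => Q_le_of_forall_gt fun y hy => ?_
    rw [mem_E_zero_iff hX]
    rw [mem_E_zero_iff hY] at hx
    have hle := hg x (by simp [T])
    rw [lintegral_g_zero hX, lintegral_g_zero hY] at hle
    calc μ {ω | y ≤ X ω} ≤ μ {ω | x < X ω} := measure_mono fun ω hω => hy.trans_le hω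
      _ ≤ ν {ω | x < Y ω} := hle
      _ ≤ ν {ω | x ≤ Y ω} := measure_mono fun ω (hω : x < Y ω) => show x ≤ Y ω from hω.le
      _ < ENNReal.ofReal p := hx
  refine Q_mono_of_A_le fun x l hl => ?_
  rcases eq_or_ne α ∞ with rfl | h1
  · rw [A_top_eq, A_top_eq]
    refine mul_le_mul' le_rfl ?_
    simpa [g_top, mul_comm l] using hg (1 / l) (by simpa [T] using hl)
  · have ha := ENNReal.toReal_pos h0 h1
    have ht : x - α.toReal / l < x := by linarith [div_pos ha hl]
    have he : α.toReal / (x - (x - α.toReal / l)) = l := by field_simp; simp [ha.ne']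
    rw [← he, A_div_sub h0 h1 ht, A_div_sub h0 h1 ht]
    refine mul_le_mul' le_rfl ?_
    simpa [g, h0, h1] using hg (x - α.toReal / l) (by simp [T, h1])

end Dominance

/-! ### Stability under weak convergence and in the index. -/

section Stability

/-- Fatou's lemma for weakly converging probability measures and varying integrands. -/
theorem lintegral_le_liminf_lintegral_of_tendsto {μ : ProbabilityMeasure ℝ}
    {μs : ℕ → ProbabilityMeasure ℝ} (hμ : Tendsto μs atTop (𝓝 μ)) {f : ℕ → ℝ → ℝ} {g : ℝ → ℝ}
    (hf0 : ∀ n u, 0 ≤ f n u) (hf : ∀ n, Measurable (f n)) (hg0 : ∀ u, 0 ≤ g u)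
    (hg : Measurable g)
    (hfg : ∀ u, ∀ c < g u, ∀ᶠ z : ℕ × ℝ in atTop ×ˢ 𝓝 u, c < f z.1 z.2) :
    ∫⁻ u, ENNReal.ofReal (g u) ∂(μ : Measure ℝ) ≤
      liminf (fun n => ∫⁻ u, ENNReal.ofReal (f n u) ∂(μs n : Measure ℝ)) atTop := by
  -- The layer-cake formula and the usual Fatou lemma in the height `s` reduce the claim to
  -- superlevel sets.
  rw [lintegral_eq_lintegral_meas_lt _ (Eventually.of_forall hg0) hg.aemeasurable]
  simp_rw [fun n => lintegral_eq_lintegral_meas_lt (μs n : Measure ℝ)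
    (Eventually.of_forall (hf0 n)) (hf n).aemeasurable]
  refine le_trans (lintegral_mono fun s => ?_) (lintegral_liminf_le fun n =>
    Antitone.measurable fun s t hst => measure_mono fun u (hu : t < f n u) =>
      show s < f n u from hst.trans_lt hu)
  -- These open sets increase and cover `{g > s}`, so the portmanteau inequality for each `O m` is
  -- enough.
  let O : ℕ → Set ℝ := fun m => interior {u | ∀ n ≥ m, s < f n u}
  have hO : Monotone O := fun m k hmk => interior_mono fun u (hu : ∀ n ≥ m, s < f n u) =>
    show ∀ n ≥ k, s < f n u from fun n hn => hu n (hmk.trans hn)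
  have hsub : {u | s < g u} ⊆ ⋃ m, O m := by
    intro u hu
    obtain ⟨A, hA, B, hB, hAB⟩ := eventually_prod_iff.1 (hfg u s hu)
    obtain ⟨m, hm⟩ := eventually_atTop.1 hA
    refine mem_iUnion.2 ⟨m, mem_interior_iff_mem_nhds.2 ?_⟩
    filter_upwards [hB] with v hv n hn
    exact hAB (hm n hn) hv
  refine (measure_mono hsub).trans ?_
  rw [hO.measure_iUnion]
  refine iSup_le fun m => ?_
  refine (ProbabilityMeasure.le_liminf_measure_open_of_tendsto hμ isOpen_interior).trans ?_
  refine liminf_le_liminf ?_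
  filter_upwards [eventually_ge_atTop m] with n hn
  refine measure_mono fun u hu => ?_
  have hu' : ∀ n ≥ m, s < f n u := interior_subset hu
  exact hu' n hn

variable {Ω : Type*} [MeasurableSpace Ω] {μ : Measure Ω} [IsProbabilityMeasure μ] {X : Ω → ℝ}
  {α : ℝ≥0∞} {p x y : ℝ}

/-- A nonstrict moment bound at `p` is strict at every level `q > p`; continuity in the level lets
`q` decrease to `p`. Fatou limits yield only nonstrict bounds. -/
lemma Q_le_of_A_le (hα : α ≠ 0) (hX : MemX α μ X) (hp : p ∈ Ioo (0 : ℝ) 1) {l : ℝ} (hl : 0 < l)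
    (hA : A α μ X y l ≤ ENNReal.ofReal p) : Q α μ X p ≤ y := by
  have hcont : Tendsto (fun q => Q α μ X q) (𝓝[>] p) (𝓝 (Q α μ X p)) :=
    ((continuousOn_Q hα hX).continuousAt (Ioo_mem_nhds hp.1 hp.2)).tendsto.mono_left
      nhdsWithin_le_nhds
  refine le_of_tendsto hcont ?_
  filter_upwards [Ioo_mem_nhdsGT hp.2] with q hq
  exact Q_le (mem_E_iff.2 ⟨l, hl, hA.trans_lt
    ((ENNReal.ofReal_lt_ofReal_iff (hp.1.trans hq.1)).2 hq.1)⟩)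

variable {S : ℕ → Type*} [∀ n, MeasurableSpace (S n)] {ν : ∀ n, Measure (S n)}
  [∀ n, IsProbabilityMeasure (ν n)] {Xs : ∀ n, S n → ℝ} {a : ℕ → ℝ≥0∞}

/-- Sequential lower semicontinuity of `Q` jointly in the index and in the distribution. -/
theorem Q_le_of_frequently_mem_E (hα : α ≠ 0) (hX : MemX α μ X) (hp : p ∈ Ioo (0 : ℝ) 1)
    (ha : Tendsto a atTop (𝓝 α)) (hXs : TendstoInDistribution Xs atTop X ν μ)
    (hy : ∃ᶠ n in atTop, y ∈ E (a n) (ν n) (Xs n) p) : Q α μ X p ≤ y := by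
  obtain ⟨φ, hφ, hE⟩ := extraction_of_frequently_atTop hy
  choose l hl hA using fun k => mem_E_iff.1 (hE k)
  -- The multipliers need not be bounded, nor bounded away from `0`, so the limit is taken in `[0,
  -- ∞]` and its three regimes are treated apart.
  obtain ⟨L, ψ, hψ, hL⟩ := CompactSpace.tendsto_subseq fun k => ENNReal.ofReal (l k)
  have hσ : Tendsto (φ ∘ ψ) atTop atTop := hφ.tendsto_atTop.comp hψ.tendsto_atTop
  have haσ : Tendsto (fun k => a (φ (ψ k))) atTop (𝓝 α) := ha.comp hσ
  have hbound : ∀ g : ℝ → ℝ, (∀ u, 0 ≤ g u) → Measurable g →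
      (∀ u, ∀ c < g u, ∀ᶠ z : ℕ × ℝ in atTop ×ˢ 𝓝 u,
        c < h (a (φ (ψ z.1))) (l (ψ z.1) * (z.2 - y))) →
      ∫⁻ ω, ENNReal.ofReal (g (X ω)) ∂μ ≤ ENNReal.ofReal p := by
    intro g hg0 hg hfg
    have hF := lintegral_le_liminf_lintegral_of_tendsto (hXs.tendsto.comp hσ)
      (f := fun k u => h (a (φ (ψ k))) (l (ψ k) * (u - y)))
      (fun _ _ => h_nonneg _ _) (fun _ => by fun_prop) hg0 hg hfg
    change ∫⁻ u, ENNReal.ofReal (g u) ∂(μ.map X) ≤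
      liminf (fun k => ∫⁻ u, ENNReal.ofReal (h (a (φ (ψ k))) (l (ψ k) * (u - y)))
        ∂((ν (φ (ψ k))).map (Xs (φ (ψ k))))) atTop at hF
    rw [lintegral_map (by fun_prop) hX.1] at hF
    refine hF.trans (liminf_le_of_le (by isBoundedDefault) fun b hb => ?_)
    obtain ⟨k, hk⟩ := hb.exists
    rw [← A_map (hXs.forall_aemeasurable _)] at hk
    exact hk.trans (hA (ψ k)).le
  -- If `L = ∞`, the integrands blow up on `{X > y}`, so `K * P(X > y) ≤ p` for every `K` and thus
  -- `X ≤ y` almost surely.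
  rcases eq_or_ne L ∞ with rfl | hL1
  · have hl' : Tendsto (fun k => l (ψ k)) atTop atTop := by
      refine tendsto_atTop.2 fun b => ?_
      filter_upwards [hL.eventually_const_lt ENNReal.ofReal_lt_top (u := ENNReal.ofReal b)]
        with k hk
      exact ((ENNReal.ofReal_lt_ofReal_iff (hl _)).1 hk).le
    -- A fixed index `γ < α` eventually lies below the varying indices, so `h γ` supplies the
    -- growth.
    obtain ⟨γ, hγ0, hγα⟩ := exists_between (pos_iff_ne_zero.2 hα)
    have hK : ∀ K : ℝ, 0 ≤ K → ENNReal.ofReal K * μ {ω | y < X ω} ≤ ENNReal.ofReal p := by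
      intro K hK0
      have hmeas : MeasurableSet {ω | y < X ω} := measurableSet_lt measurable_const hX.1
      have hb := hbound (fun u => if y < u then K else 0) (fun u => by positivity)
        (Measurable.ite measurableSet_Ioi measurable_const measurable_const) fun u c hc => ?_
      · refine le_trans (le_of_eq ?_) hb
        rw [← lintegral_indicator_const hmeas]
        refine lintegral_congr fun ω => ?_
        by_cases hω : y < X ω <;> simp [hω]
      · rcases lt_or_ge y u with hu | hu
        · rw [if_pos hu] at hc
          have hlim : Tendsto (fun z : ℕ × ℝ => l (ψ z.1) * (z.2 - y)) (atTop ×ˢ 𝓝 u) atTop :=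
            (hl'.comp tendsto_fst).atTop_mul_pos (sub_pos.2 hu) (tendsto_snd.sub_const y)
          filter_upwards [((tendsto_h_atTop hγ0.ne').comp hlim).eventually_gt_atTop c,
            (haσ.comp tendsto_fst).eventually_const_lt hγα] with z hz1 hz2
          exact hz1.trans_le (h_mono_left hz2.le _)
        · rw [if_neg hu.not_gt] at hc
          exact Eventually.of_forall fun z => hc.trans_le (h_nonneg _ _)
    have hzero : μ {ω | y < X ω} = 0 := by
      by_contra hne
      have hm := ENNReal.toReal_pos hne (measure_ne_top _ _)
      have h1 := hK (1 / (μ {ω | y < X ω}).toReal) (by positivity)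
      nth_rewrite 2 [← ENNReal.ofReal_toReal (measure_ne_top μ {ω | y < X ω})] at h1
      rw [← ENNReal.ofReal_mul (by positivity), one_div_mul_cancel hm.ne',
        ENNReal.ofReal_le_ofReal_iff hp.1.le] at h1
      exact absurd hp.2 (not_lt.2 h1)
    refine Q_le_of_ae_le hX.1 hp.1 ?_
    rw [ae_iff]
    simpa using hzero
  · have hl' : Tendsto (fun k => l (ψ k)) atTop (𝓝 L.toReal) :=
      ((ENNReal.tendsto_toReal hL1).comp hL).congr fun k => ENNReal.toReal_ofReal (hl _).le
    have hb := hbound (fun u => h α (L.toReal * (u - y))) (fun _ => h_nonneg _ _) (by fun_prop)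
      fun u c hc => (tendsto_h hα (haσ.comp tendsto_fst)
        ((hl'.comp tendsto_fst).mul (tendsto_snd.sub_const y))).eventually_const_lt hc
    -- If `L = 0`, the limiting integrand is identically `1`, giving `1 ≤ p`; otherwise `L` is a
    -- genuine multiplier for `X`.
    rcases (ENNReal.toReal_nonneg (a := L)).eq_or_lt with h0 | h0
    · simp only [← h0, zero_mul, h_zero, ENNReal.ofReal_one, lintegral_one, measure_univ,
        ENNReal.one_le_ofReal] at hb
      exact absurd hp.2 (not_lt.2 hb)
    · exact Q_le_of_A_le hα hX hp h0 hb

/-- Semicontinuity gives the lower half. The uniform integrability and domination arguments enter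
only through `hE`, which is needed for the upper half. -/
theorem tendsto_Q_of_eventually_mem_E (hα : α ≠ 0) (hX : MemX α μ X) (hp : p ∈ Ioo (0 : ℝ) 1)
    (ha : Tendsto a atTop (𝓝 α)) (hXs : TendstoInDistribution Xs atTop X ν μ)
    (hE : ∀ x ∈ E α μ X p, ∀ᶠ n in atTop, x ∈ E (a n) (ν n) (Xs n) p) :
    Tendsto (fun n => Q (a n) (ν n) (Xs n) p) atTop (𝓝 (Q α μ X p)) := by
  refine tendsto_order.2 ⟨fun z hz => ?_, fun z hz => ?_⟩
  · obtain ⟨y, hzy, hy⟩ := EReal.lt_iff_exists_real_btwn.1 hz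
    have : ∀ᶠ n in atTop, y ∉ E (a n) (ν n) (Xs n) p := by
      rw [← not_frequently]
      exact fun hfr => not_le.2 hy (Q_le_of_frequently_mem_E hα hX hp ha hXs hfr)
    filter_upwards [this] with n hn
    exact hzy.trans_le (le_Q_of_notMem hn)
  · obtain ⟨y, hy, hyz⟩ := EReal.lt_iff_exists_real_btwn.1 hz
    filter_upwards [hE y (mem_E_of_Q_lt hy)] with n hn
    exact (Q_le hn).trans_lt hyz

/-- An upper bound for `h` by the function in the uniform integrability condition. -/
lemma exists_h_le_mul_rpow (h0 : α ≠ 0) (h1 : α ≠ ∞) (x : ℝ) {l : ℝ} (hl : 0 < l) :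
    ∃ C : ℝ, 0 ≤ C ∧ ∀ u, 1 ≤ u → h α (l * (u - x)) ≤ C * (max 0 u) ^ α.toReal := by
  have ha := ENNReal.toReal_pos h0 h1
  refine ⟨(1 + l * (1 + |x|) / α.toReal) ^ α.toReal, by positivity, fun u hu => ?_⟩
  rw [← Real.mul_rpow (by positivity) (by positivity), h_of_ne h0 h1]
  have hu0 : 0 ≤ u := by linarith
  rw [max_eq_right hu0]
  refine Real.rpow_le_rpow (le_max_left _ _) (max_le (by positivity) ?_) ha.le
  have hux : u - x ≤ (1 + |x|) * u := by nlinarith [neg_abs_le x, abs_nonneg x]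
  calc 1 + l * (u - x) / α.toReal ≤ u + l * ((1 + |x|) * u) / α.toReal := by gcongr
    _ = (1 + l * (1 + |x|) / α.toReal) * u := by ring

lemma tendsto_lintegral_min_h (hα : α ≠ 0) (hX : Measurable X) (hXm : ∀ n, Measurable (Xs n))
    (hXs : TendstoInDistribution Xs atTop X ν μ) (x l : ℝ) {c : ℝ} (hc : 0 ≤ c) :
    Tendsto (fun n => ∫⁻ ω, ENNReal.ofReal (min (h α (l * (Xs n ω - x))) c) ∂(ν n)) atTop
      (𝓝 (∫⁻ ω, ENNReal.ofReal (min (h α (l * (X ω - x))) c) ∂μ)) := by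
  have hcont : Continuous fun u => min (h α (l * (u - x))) c :=
    ((continuous_h hα).comp (by fun_prop)).min continuous_const
  let f : BoundedContinuousFunction ℝ ℝ≥0 := BoundedContinuousFunction.mkOfBound
    ⟨fun u => (min (h α (l * (u - x))) c).toNNReal, continuous_real_toNNReal.comp hcont⟩ c fun u v => by
      have hb : ∀ u, 0 ≤ min (h α (l * (u - x))) c := fun u => le_min (h_nonneg _ _) hc
      have hb' : ∀ u, min (h α (l * (u - x))) c ≤ c := fun u => min_le_right _ _
      rw [NNReal.dist_eq]
      simp only [ContinuousMap.coe_mk, Real.coe_toNNReal _ (hb _)]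
      rw [abs_le]
      constructor <;> linarith [hb u, hb v, hb' u, hb' v]
  have hlim := ProbabilityMeasure.tendsto_iff_forall_lintegral_tendsto.1 hXs.tendsto f
  change Tendsto (fun n => ∫⁻ u, ENNReal.ofReal (min (h α (l * (u - x))) c) ∂((ν n).map (Xs n)))
    atTop (𝓝 (∫⁻ u, ENNReal.ofReal (min (h α (l * (u - x))) c) ∂(μ.map X))) at hlim
  have hm : Measurable fun u => ENNReal.ofReal (min (h α (l * (u - x))) c) :=
    hcont.measurable.ennreal_ofReal
  rw [lintegral_map hm hX] at hlim
  exact hlim.congr fun n => by rw [lintegral_map hm (hXm n)]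

/-- Truncating `h` at its value at `N` gives a bounded continuous integrand, to which convergence in
distribution applies; the error is at most `C` times the tail supremum, uniformly in `n`. The
function `ψ` stands for either a power or an exponential. -/
lemma eventually_A_lt (hα : α ≠ 0) (hX : Measurable X) (hXm : ∀ n, Measurable (Xs n))
    (hXs : TendstoInDistribution Xs atTop X ν μ) {l : ℝ} (hl : 0 < l) {ψ : ℝ → ℝ≥0∞}
    {C c : ℝ≥0∞} (hC : C ≠ ∞)
    (hψ : ∀ u, 1 ≤ u → ENNReal.ofReal (h α (l * (u - x))) ≤ C * ψ u)
    (htail : Tendsto (fun N : ℝ => ⨆ n, ∫⁻ ω, {ω | N < Xs n ω}.indicator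
      (fun ω => ψ (Xs n ω)) ω ∂(ν n)) atTop (𝓝 0))
    (hA : A α μ X x l < c) : ∀ᶠ n in atTop, A α (ν n) (Xs n) x l < c := by
  have hlim := (tendsto_const_nhds (x := A α μ X x l)).add
    (ENNReal.Tendsto.const_mul (a := C) htail (Or.inr hC))
  rw [mul_zero, add_zero] at hlim
  obtain ⟨N, hN, hN1⟩ := ((hlim.eventually_lt_const hA).and (eventually_ge_atTop 1)).exists
  set Sup := ⨆ n, ∫⁻ ω, {ω | N < Xs n ω}.indicator (fun ω => ψ (Xs n ω)) ω ∂(ν n) with hSup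
  have hmin := tendsto_lintegral_min_h hα hX hXm hXs x l (c := h α (l * (N - x))) (h_nonneg _ _)
  have hle : ∫⁻ ω, ENNReal.ofReal (min (h α (l * (X ω - x))) (h α (l * (N - x)))) ∂μ
      ≤ A α μ X x l := lintegral_mono fun ω => ENNReal.ofReal_le_ofReal (min_le_left _ _)
  have hlt := (add_le_add_left hle (C * Sup)).trans_lt hN
  filter_upwards [(hmin.add_const (C * Sup)).eventually_lt_const hlt] with n hn
  refine lt_of_le_of_lt ?_ hn
  have hXn := hXm n
  calc A α (ν n) (Xs n) x l
      ≤ ∫⁻ ω, (ENNReal.ofReal (min (h α (l * (Xs n ω - x))) (h α (l * (N - x)))) +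
          C * {ω | N < Xs n ω}.indicator (fun ω => ψ (Xs n ω)) ω) ∂(ν n) := by
        refine lintegral_mono fun ω => ?_
        rcases lt_or_ge N (Xs n ω) with hω | hω
        · simp only [indicator, mem_ofPred_eq, hω, if_true]
          exact (hψ _ (hN1.trans hω.le)).trans le_add_self
        · rw [min_eq_left (h_mono α (mul_le_mul_of_nonneg_left (by linarith) hl.le))]
          exact le_self_add
    _ = ∫⁻ ω, ENNReal.ofReal (min (h α (l * (Xs n ω - x))) (h α (l * (N - x)))) ∂(ν n) +
          C * ∫⁻ ω, {ω | N < Xs n ω}.indicator (fun ω => ψ (Xs n ω)) ω ∂(ν n) := by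
        rw [lintegral_add_left (by fun_prop), lintegral_const_mul' _ _ hC]
    _ ≤ _ := by
        gcongr
        exact le_iSup (fun n => ∫⁻ ω, {ω | N < Xs n ω}.indicator (fun ω => ψ (Xs n ω)) ω ∂(ν n)) n

theorem tendsto_Q_of_tendstoInDistribution (hα : α ≠ 0) (hX : MemX α μ X)
    (hp : p ∈ Ioo (0 : ℝ) 1) (hXm : ∀ n, Measurable (Xs n))
    (hXs : TendstoInDistribution Xs atTop X ν μ) (hUI : UnifIntCond α μ X ν Xs) :
    Tendsto (fun n => Q α (ν n) (Xs n) p) atTop (𝓝 (Q α μ X p)) := by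
  refine tendsto_Q_of_eventually_mem_E hα hX hp tendsto_const_nhds hXs fun x hx => ?_
  obtain ⟨l, hl, hA⟩ := mem_E_iff.1 hx
  have : ∀ᶠ n in atTop, A α (ν n) (Xs n) x l < ENNReal.ofReal p := by
    rcases eq_or_ne α ∞ with rfl | h1
    · have hL : l ∈ Lam μ X := mem_Lam_of_A_lt_top hl (hA.trans ENNReal.ofReal_lt_top)
      refine eventually_A_lt (ψ := fun u => ENNReal.ofReal (Real.exp (l * u))) hα hX.1 hXm hXs hl
        (C := ENNReal.ofReal (Real.exp (-(l * x))))
        ENNReal.ofReal_ne_top (fun u _ => le_of_eq ?_) (hUI.2 rfl l hL) hA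
      rw [← ENNReal.ofReal_mul (by positivity), h_top, ← Real.exp_add]
      congr 2
      ring
    · obtain ⟨C, hC, hle⟩ := exists_h_le_mul_rpow hα h1 x hl
      refine eventually_A_lt (ψ := fun u => ENNReal.ofReal ((max 0 u) ^ α.toReal)) hα hX.1 hXm hXs hl
        (C := ENNReal.ofReal C)
        ENNReal.ofReal_ne_top (fun u hu => ?_) (hUI.1 hα h1) hA
      rw [← ENNReal.ofReal_mul hC]
      exact ENNReal.ofReal_le_ofReal (hle u hu)
  exact this.mono fun n hn => mem_E_iff.2 ⟨l, hl, hn⟩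

theorem tendsto_Q_of_tendsto_left (hα : α ≠ 0) (hX : MemX α μ X) (hp : p ∈ Ioo (0 : ℝ) 1)
    {b : ℕ → ℝ≥0} (hb : Tendsto (fun n => (b n : ℝ≥0∞)) atTop (𝓝 α))
    (hsup : MemX (⨆ n, (b n : ℝ≥0∞)) μ X) :
    Tendsto (fun n => Q (b n : ℝ≥0∞) μ X p) atTop (𝓝 (Q α μ X p)) := by
  refine tendsto_Q_of_eventually_mem_E (S := fun _ => Ω) (ν := fun _ => μ) (Xs := fun _ => X)
    hα hX hp hb (tendstoInDistribution_const hX.1.aemeasurable) fun x hx => ?_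
  obtain ⟨l, hl, hA⟩ := mem_E_iff.1 hx
  rcases eq_or_ne α ∞ with rfl | h1
  -- Here no limit is needed: moments increase with the index, so the strict bound at `∞` holds for
  -- every `b n`.
  · exact Eventually.of_forall fun n => mem_E_iff.2 ⟨l, hl, (A_mono_left le_top x l).trans_lt hA⟩
  set β : ℝ≥0∞ := ⨆ n, (b n : ℝ≥0∞) with hβ
  have hbβ : ∀ n, (b n : ℝ≥0∞) ≤ β := fun n => le_iSup (fun n => (b n : ℝ≥0∞)) n
  have hβ0 : β ≠ 0 := fun h0 => hα (le_antisymm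
    (le_of_tendsto' hb fun n => (hbβ n).trans h0.le) bot_le)
  have hβ1 : β ≠ ∞ := by
    lift α to ℝ≥0 using h1
    exact (ENNReal.iSup_coe_lt_top.2 (ENNReal.tendsto_coe.1 hb).bddAbove_range).ne
  have hfin : A β μ X x l < ∞ := by
    have ha := ENNReal.toReal_pos hβ0 hβ1
    have ht : x - β.toReal / l < x := by linarith [div_pos ha hl]
    have he : β.toReal / (x - (x - β.toReal / l)) = l := by field_simp; simp [ha.ne']
    rw [← he, A_div_sub hβ0 hβ1 ht]
    exact ENNReal.mul_lt_top ENNReal.ofReal_lt_top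
      (lintegral_posPart_sub_lt_top ha (hsup.2.1 hβ0 hβ1) _)
  have hlim : Tendsto (fun n => A (b n : ℝ≥0∞) μ X x l) atTop (𝓝 (A α μ X x l)) := by
    have hXm := hX.1
    -- The integrable dominating function is the one of the largest index `β`, which is finite
    -- because the sequence converges in `ℝ≥0`.
    refine tendsto_lintegral_of_dominated_convergence
      (fun ω => ENNReal.ofReal (h β (l * (X ω - x)))) (fun n => by fun_prop)
      (fun n => ae_of_all _ fun ω => ENNReal.ofReal_le_ofReal (h_mono_left (hbβ n) _)) hfin.ne
      (ae_of_all _ fun ω => ?_)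
    exact (ENNReal.continuous_ofReal.tendsto _).comp (tendsto_h hα hb tendsto_const_nhds)
  filter_upwards [hlim.eventually_lt_const hA] with n hn
  exact mem_E_iff.2 ⟨l, hl, hn⟩

end Stability

/-! ### Translation and scaling. -/

section Equivariance

variable {Ω : Type*} [MeasurableSpace Ω] {μ : Measure Ω} {X : Ω → ℝ} {α : ℝ≥0∞} {p r : ℝ}

theorem Q_add_const (hr : Q α μ X p = r) (c : ℝ) :
    Q α μ (fun ω => X ω + c) p = Q α μ X p + (c : EReal) := by
  rw [hr, ← EReal.coe_add]
  refine le_antisymm (Q_add_const_le c hr.le) (not_lt.1 fun hlt => ?_)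
  obtain ⟨s, hs, hsr⟩ := EReal.lt_iff_exists_real_btwn.1 hlt
  have hback := Q_add_const_le (-c) hs.le
  simp only [add_neg_cancel_right] at hback
  rw [hr, EReal.coe_le_coe_iff] at hback
  rw [EReal.coe_lt_coe_iff] at hsr
  linarith

theorem Q_const_mul [IsProbabilityMeasure μ] (hX : MemX α μ X) (hp : p ∈ Ioo (0 : ℝ) 1) {κ : ℝ}
    (hκ : 0 ≤ κ) : Q α μ (fun ω => κ * X ω) p = (κ : EReal) * Q α μ X p := by
  rcases hκ.eq_or_lt with rfl | hκ
  · simpa using Q_const (α := α) (μ := μ) 0 hp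
  obtain ⟨r, hr⟩ := exists_Q_eq_coe hX hp
  rw [hr, ← EReal.coe_mul]
  refine le_antisymm (Q_mul_const_le hκ hr.le) (not_lt.1 fun hlt => ?_)
  obtain ⟨s, hs, hsr⟩ := EReal.lt_iff_exists_real_btwn.1 hlt
  have hback := Q_mul_const_le (inv_pos.2 hκ) hs.le
  simp only [inv_mul_cancel_left₀ hκ.ne'] at hback
  rw [hr, EReal.coe_le_coe_iff, le_inv_mul_iff₀ hκ] at hback
  rw [EReal.coe_lt_coe_iff] at hsr
  linarith

end Equivariance

end QuantileBounds



/-! ### Assembly of the clauses. -/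

theorem theorem2 {Ω : Type u} [MeasurableSpace Ω] (μ : Measure Ω)
    [IsProbabilityMeasure μ] (α : ℝ≥0∞) (X : Ω → ℝ) (hX : MemX α μ X)
    (p : ℝ) (hp : p ∈ Ioo (0 : ℝ) 1) :
    -- model-independence
    (∀ (Ω' : Type v) [MeasurableSpace Ω'] (ν : Measure Ω') [IsProbabilityMeasure ν] (Y : Ω' → ℝ),
      IdentDistrib X Y μ ν → Q α μ X p = Q α ν Y p) ∧
    -- monotonicity in X: stochastic dominance of order α + 1
    (∀ (Ω' : Type v) [MeasurableSpace Ω'] (ν : Measure Ω') [IsProbabilityMeasure ν] (Y : Ω' → ℝ),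
      Measurable Y → StochDom α μ X ν Y → Q α μ X p ≤ Q α ν Y p) ∧
    -- monotonicity in X: stochastic dominance of any order γ = β + 1 in [1, α + 1]
    (∀ (Ω' : Type v) [MeasurableSpace Ω'] (ν : Measure Ω') [IsProbabilityMeasure ν] (Y : Ω' → ℝ),
      Measurable Y → ∀ β : ℝ≥0∞, β ≤ α → StochDom β μ X ν Y → Q α μ X p ≤ Q α ν Y p) ∧
    -- monotonicity in X: in particular, X ≤ Y
    (∀ Y : Ω → ℝ, Measurable Y → (∀ᵐ ω ∂μ, X ω ≤ Y ω) → Q α μ X p ≤ Q α μ Y p) ∧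
    -- monotonicity in α
    (∀ β : ℝ≥0∞, α ≤ β → Q α μ X p ≤ Q β μ X p) ∧
    -- monotonicity in p
    (AntitoneOn (fun q => Q α μ X q) (Ioo 0 1)) ∧
    (α ≠ 0 → StrictAntiOn (fun q => Q α μ X q) {q | q ∈ Ioo (0 : ℝ) 1 ∧
      pStar μ X ≤ ENNReal.ofReal q}) ∧
    -- finiteness
    (∃ r : ℝ, Q α μ X p = (r : EReal)) ∧
    -- concavity in p^(-1/α) or in ln(1/p)
    (α ≠ 0 → α ≠ ∞ → ∃ f : ℝ → ℝ, ConcaveOn ℝ (Ioi 1) f ∧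
      ∀ q ∈ Ioo (0 : ℝ) 1, Q α μ X q = (f (q ^ (-(1 / α.toReal))) : EReal)) ∧
    (α = ∞ → ∃ f : ℝ → ℝ, ConcaveOn ℝ (Ioi 0) f ∧
      ∀ q ∈ Ioo (0 : ℝ) 1, Q α μ X q = (f (Real.log (1 / q)) : EReal)) ∧
    -- stability in p
    (α ≠ 0 → ContinuousOn (fun q => Q α μ X q) (Ioo 0 1)) ∧
    -- stability in X
    (α ≠ 0 → ∀ (S : ℕ → Type w) [∀ n, MeasurableSpace (S n)] (ν : ∀ n, Measure (S n))
      [∀ n, IsProbabilityMeasure (ν n)] (Xs : ∀ n, S n → ℝ),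
      (∀ n, Measurable (Xs n)) → TendstoInDistribution Xs atTop X ν μ →
      UnifIntCond α μ X ν Xs →
      Tendsto (fun n => Q α (ν n) (Xs n) p) atTop (𝓝 (Q α μ X p))) ∧
    -- stability in α
    (α ≠ 0 → ∀ a : ℕ → ℝ≥0, Tendsto (fun n => (a n : ℝ≥0∞)) atTop (𝓝 α) →
      MemX (⨆ n, (a n : ℝ≥0∞)) μ X →
      Tendsto (fun n => Q (a n : ℝ≥0∞) μ X p) atTop (𝓝 (Q α μ X p))) ∧
    -- translation invariance
    (∀ c : ℝ, Q α μ (fun ω => X ω + c) p = Q α μ X p + (c : EReal)) ∧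
    -- consistency
    (∀ c : ℝ, Q α μ (fun _ => c) p = (c : EReal)) ∧
    -- sensitivity
    ((∀ᵐ ω ∂μ, 0 ≤ X ω) →
      (0 < μ {ω | 0 < X ω} → α ≠ 0 → 0 < Q α μ X p) ∧
      (ENNReal.ofReal p < μ {ω | 0 < X ω} → 0 < Q 0 μ X p)) ∧
    -- positive homogeneity
    (∀ κ : ℝ, 0 ≤ κ → Q α μ (fun ω => κ * X ω) p = (κ : EReal) * Q α μ X p) ∧
    -- subadditivity
    (1 ≤ α → ∀ Y : Ω → ℝ, MemX α μ Y →
      Q α μ (fun ω => X ω + Y ω) p ≤ Q α μ X p + Q α μ Y p) ∧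
    -- convexity
    (1 ≤ α → ∀ Y : Ω → ℝ, MemX α μ Y → ∀ t ∈ Ioo (0 : ℝ) 1,
      Q α μ (fun ω => (1 - t) * X ω + t * Y ω) p
        ≤ ((1 - t : ℝ) : EReal) * Q α μ X p + (t : EReal) * Q α μ Y p) := by
  have hreal := fun (Z : Ω → ℝ) (hZ : MemX α μ Z) => exists_Q_eq_coe hZ hp
  obtain ⟨r, hr⟩ := hreal X hX
  have hmul : ∀ κ : ℝ, 0 ≤ κ → ∀ Z : Ω → ℝ, MemX α μ Z →
      Q α μ (fun ω => κ * Z ω) p = (κ : EReal) * Q α μ Z p :=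
    fun κ hκ Z hZ => Q_const_mul hZ hp hκ
  refine ⟨?_, ?_, ?_, ?_, ?_, ?_, ?_, ⟨r, hr⟩, ?_, ?_, ?_, ?_, ?_, ?_, ?_, ?_, ?_, ?_, ?_⟩
  · intro Ω' _ ν _ Y hXY
    exact Q_congr_identDistrib hXY
  · intro Ω' _ ν _ Y hY hdom
    exact hdom.Q_le_Q le_rfl hX.1 hY
  · intro Ω' _ ν _ Y hY β hβ hdom
    exact hdom.Q_le_Q hβ hX.1 hY
  · intro Y _ hXY
    exact Q_mono_of_ae_le hXY
  · intro β hβ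
    exact Q_mono_left hβ
  · exact fun q _ q' _ hqq' => Q_anti hqq'
  · exact fun hα => strictAntiOn_Q hα hX
  · intro hα h1
    simpa [levelRange, levelParam, h1] using exists_concaveOn hα hX
  · rintro rfl
    simpa only [levelRange, levelParam, if_true] using exists_concaveOn ENNReal.top_ne_zero hX
  · exact fun hα => continuousOn_Q hα hX
  · intro hα S _ ν _ Xs hXm hXs hUI
    exact tendsto_Q_of_tendstoInDistribution hα hX hp hXm hXs hUI
  · intro hα a ha hsup
    exact tendsto_Q_of_tendsto_left hα hX hp ha hsup
  · exact fun c => Q_add_const hr c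
  · exact fun c => Q_const c hp
  · exact fun h0 => ⟨fun hpos hα => Q_pos hα hX hp h0 hpos, Q_zero_pos hX.1⟩
  · exact fun κ hκ => hmul κ hκ X hX
  · intro hα Y hY
    obtain ⟨s, hs⟩ := hreal Y hY
    rw [hr, hs, ← EReal.coe_add]
    exact Q_add_le hX.1 hα hr.le hs.le hp.1
  · intro hα Y hY t ht
    obtain ⟨s, hs⟩ := hreal Y hY
    have h1 := hmul (1 - t) (sub_nonneg.2 ht.2.le) X hX
    have h2 := hmul t ht.1.le Y hY
    rw [hr, ← EReal.coe_mul] at h1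
    rw [hs, ← EReal.coe_mul] at h2
    rw [hr, hs, ← EReal.coe_mul, ← EReal.coe_mul, ← EReal.coe_add]
    -- Convexity is subadditivity applied to `(1 - t) X` and `t Y`, whose bounds are known by
    -- homogeneity.
    exact Q_add_le (hX.1.const_mul _) hα h1.le h2.le hp.1
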